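/- **Theorem (Representation guarantee for DPSS vectors).** Let $N\ge 1$ be an integer and $W\in(0,\tfrac12)$. *Notation.* Let $\mathbf e_f=(e^{2\pi i f m})_{0\le m<N}\in\mathbb C^N$, and let $\mathbf F_{N,W}$ be the $N\times(2\lfloor NW\rfloor+1)$ matrix with columns $N^{-1/2}\mathbf e_{k/N}$, $-\lfloor NW\rfloor\le k\le\lfloor NW\rfloor$, and $\overline{\mathbf F}_{N,W}$ the $N\times M$ matrix, $M=N-2\lfloor NW\rfloor-1$, whose columns are the remaining normalized DFT vectors $N^{-1/2}\mathbf e_{k/N}$, $\lfloor NW\rfloor<k<N-\lfloor NW\rfloor$. Let $\mathbf B_{N,W}$ be the $N\times N$ prolate matrix with entries $\frac{\sin(2\pi W(m-n))}{\pi(m-n)}$ (equal to $2W$ for $m=n$). Let $s^{(0)},\dots,s^{(N-1)}\in\ell_2(\mathbb Z)$ be the discrete prolate spheroidal sequences: real sequences with $\mathcal B_W\mathcal T_N s^{(\ell)}=\lambda^{(\ell)}s^{(\ell)}$, $\lambda^{(0)}\ge\lambda^{(1)}\ge\dots\ge\lambda^{(N-1)}$, where $\mathcal T_N$ sets all entries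 outside $\{0,\dots,N-1\}$ to zero and $\mathcal B_W$ restricts the discrete-time Fourier transform to $[-W,W]$, such that the restrictions $\mathbf s^{(\ell)}\in\mathbb R^N$ of $s^{(\ell)}$ to $\{0,\dots,N-1\}$ (the DPSS vectors) are orthonormal. For $1\le K\le N$ let $\mathbf S_K=[\mathbf s^{(0)}\ \cdots\ \mathbf s^{(K-1)}]$. Put $C_N=\frac{4}{\pi^2}\log(8N)+6$ and let $\|\cdot\|$ be the spectral norm of a matrix. For nonzero subspaces $\mathcal S,\mathcal T$ of $\mathbb C^N$ with $\dim\mathcal S\le\dim\mathcal T$, the angle $\Theta\in[0,\tfrac{\pi}{2}]$ between them (the largest principal angle) is given by $\cos\Theta=\inf\{\|P_{\mathcal T}\mathbf a\|_2:\mathbf a\in\mathcal S,\ \|\mathbf a\|_2=1\}$, $P_{\mathcal T}$ being the orthogonal projection onto $\mathcal T$; if $\dim\mathcal S>\dim\mathcal T$ the roles are exchanged. *Claim.* Let $\epsilon\in(0,\tfrac12)$ and let $K\in\{1,\dots,N\}$ be such that $\lambda^{(K-1)}\ge\epsilon$. For a positive integer $R$ let $\mathbf V$ have as columns the $\min(R,M)$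 dominant left singular vectors of $\overline{\mathbf F}_{N,W}^*\mathbf B_{N,W}$ (the first columns of the left unitary factor of any singular value decomposition with nonincreasing singular values), and let $\mathbf Q=[\mathbf F_{N,W}\ \ \overline{\mathbf F}_{N,W}\mathbf V]$. 1. If $R=\lceil C_N\log(15/\epsilon)\rceil$, then $\mathbf Q$ has orthonormal columns, $$\|\mathbf S_K\mathbf S_K^*-\mathbf Q\mathbf Q^*\mathbf S_K\mathbf S_K^*\|^2\le\epsilon,\qquad \|\mathbf s^{(\ell)}-\mathbf Q\mathbf Q^*\mathbf s^{(\ell)}\|_2^2\le\epsilon\quad(\ell=0,\dots,K-1).$$ 2. If $R=\lceil C_N\log(15N/\epsilon)\rceil$, then $\mathbf Q$ has orthonormal columns and the angle $\Theta$ between the column spaces of $\mathbf S_K$ and $\mathbf Q$ satisfies $\cos\Theta\ge\sqrt{1-\epsilon}$. -/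

import Mathlib

namespace Slepian

open scoped Matrix

noncomputable section

/-- The sampled complex exponential `e_f = (exp (2πi f m))_{0 ≤ m < N}`. -/
def expVec (N : ℕ) (f : ℝ) (m : Fin N) : ℂ :=
  Complex.exp (2 * Real.pi * Complex.I * f * ((m : ℕ) : ℂ))

/-- The time-limiting operator: zero out all entries outside `{0, …, N - 1}`. -/
def timeLimit (N : ℕ) (x : ℤ → ℂ) (n : ℤ) : ℂ :=
  if 0 ≤ n ∧ n < (N : ℤ) then x n else 0

/-- The discrete-time Fourier transform `X(f) = ∑ₙ x[n] exp (-2πi f n)`.  It is only applied to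
time-limited signals below, for which the sum is finite. -/
def dtft (x : ℤ → ℂ) (f : ℝ) : ℂ :=
  ∑' n : ℤ, x n * Complex.exp (-(2 * Real.pi * Complex.I * f * (n : ℂ)))

/-- The band-limiting operator: the signal whose discrete-time Fourier transform agrees with that
of `x` on `[-W, W]` and vanishes on the rest of `[-1/2, 1/2]`. -/
def bandLimit (W : ℝ) (x : ℤ → ℂ) (m : ℤ) : ℂ :=
  ∫ f in (-W)..W, dtft x f * Complex.exp (2 * Real.pi * Complex.I * f * (m : ℂ))

/-- `s 0, …, s (N - 1)` are the discrete prolate spheroidal sequences, with eigenvalues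
`lam 0 ≥ … ≥ lam (N - 1)`: real square-summable eigensequences of band-limiting after
time-limiting, whose restrictions to `{0, …, N - 1}` are orthonormal.  (That the eigenvalues are
distinct and lie in `(0, 1)` is a consequence and is not required.) -/
structure IsDPSS (N : ℕ) (W : ℝ) (s : Fin N → ℤ → ℝ) (lam : Fin N → ℝ) : Prop where
  memlp : ∀ ℓ, Memℓp (s ℓ) 2
  eigen : ∀ ℓ (m : ℤ),
    bandLimit W (timeLimit N fun n => ((s ℓ n : ℝ) : ℂ)) m = (lam ℓ : ℂ) * ((s ℓ m : ℝ) : ℂ)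
  antitone : Antitone lam
  orthonormal : ∀ k ℓ,
    ∑ n : Fin N, s k ((n : ℕ) : ℤ) * s ℓ ((n : ℕ) : ℤ) = if k = ℓ then 1 else 0

/-- The DPSS vector: the restriction of a sequence to `{0, …, N - 1}`. -/
def dpssVec {N : ℕ} (s : Fin N → ℤ → ℝ) (ℓ : Fin N) (m : Fin N) : ℂ :=
  ((s ℓ ((m : ℕ) : ℤ) : ℝ) : ℂ)

/-- The `N × K` matrix `S_K` of the first `K` DPSS vectors. -/
def dpssMatrix {N K : ℕ} (s : Fin N → ℤ → ℝ) (hK : K ≤ N) : Matrix (Fin N) (Fin K) ℂ :=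
  Matrix.of fun m ℓ => dpssVec s (Fin.castLE hK ℓ) m

/-- The prolate matrix `B_{N,W}`, with the usual value `2W` on the diagonal. -/
def prolate (N : ℕ) (W : ℝ) : Matrix (Fin N) (Fin N) ℂ :=
  Matrix.of fun m n =>
    if m = n then ((2 * W : ℝ) : ℂ)
    else ((Real.sin (2 * Real.pi * W * (((m : ℕ) : ℝ) - ((n : ℕ) : ℝ))) /
      (Real.pi * (((m : ℕ) : ℝ) - ((n : ℕ) : ℝ))) : ℝ) : ℂ)

/-- The number `N - 2⌊NW⌋ - 1` of high-frequency DFT vectors. -/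
def numHigh (N : ℕ) (W : ℝ) : ℕ := N - 2 * ⌊(N : ℝ) * W⌋₊ - 1

/-- `F_{N,W}`: the normalized DFT vectors of frequencies `k / N`, `k = -⌊NW⌋, …, ⌊NW⌋`. -/
def lowDFT (N : ℕ) (W : ℝ) : Matrix (Fin N) (Fin (2 * ⌊(N : ℝ) * W⌋₊ + 1)) ℂ :=
  Matrix.of fun m j =>
    ((1 / Real.sqrt N : ℝ) : ℂ) * expVec N ((((j : ℕ) : ℝ) - (⌊(N : ℝ) * W⌋₊ : ℝ)) / N) m

/-- The remaining normalized DFT vectors, of frequencies `k / N`,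
`k = ⌊NW⌋ + 1, …, N - ⌊NW⌋ - 1` (frequencies are understood modulo `1`). -/
def highDFT (N : ℕ) (W : ℝ) : Matrix (Fin N) (Fin (numHigh N W)) ℂ :=
  Matrix.of fun m j =>
    ((1 / Real.sqrt N : ℝ) : ℂ) * expVec N (((⌊(N : ℝ) * W⌋₊ : ℝ) + 1 + ((j : ℕ) : ℝ)) / N) m

/-- `C_N = (4 / π²) log (8 N) + 6`. -/
def constC (N : ℕ) : ℝ := 4 / Real.pi ^ 2 * Real.log (8 * (N : ℝ)) + 6

/-- The columns of `V` are `r` dominant left singular vectors of `A`: they are the first `r`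
columns of `U` in some singular value decomposition `A = U Σ X*` with nonincreasing singular
values. -/
def IsDominantLeftSingularVectors {m n r : ℕ} (A : Matrix (Fin m) (Fin n) ℂ)
    (V : Matrix (Fin m) (Fin r) ℂ) : Prop :=
  ∃ (hr : r ≤ m) (U : Matrix (Fin m) (Fin m) ℂ) (X : Matrix (Fin n) (Fin n) ℂ) (σ : ℕ → ℝ),
    U ∈ Matrix.unitaryGroup (Fin m) ℂ ∧ X ∈ Matrix.unitaryGroup (Fin n) ℂ ∧
    Antitone σ ∧ (∀ i, 0 ≤ σ i) ∧
    A = U * (Matrix.of fun (i : Fin m) (j : Fin n) =>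
      if (i : ℕ) = (j : ℕ) then (σ i : ℂ) else 0) * Xᴴ ∧
    ∀ i j, V i j = U i (Fin.castLE hr j)

/-- `Q = [F_{N,W}  F̄_{N,W} V]`. -/
def roast (N : ℕ) (W : ℝ) {r : ℕ} (V : Matrix (Fin (numHigh N W)) (Fin r) ℂ) :
    Matrix (Fin N) (Fin (2 * ⌊(N : ℝ) * W⌋₊ + 1) ⊕ Fin r) ℂ :=
  Matrix.fromCols (lowDFT N W) (highDFT N W * V)

/-- The spectral (`ℓ²` operator) norm of a square matrix. -/
def opNorm {N : ℕ} (A : Matrix (Fin N) (Fin N) ℂ) : ℝ :=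
  ‖Matrix.toEuclideanCLM (n := Fin N) (𝕜 := ℂ) A‖

/-- The column space of a matrix. -/
def colSpace {N : ℕ} {ι : Type*} (A : Matrix (Fin N) ι ℂ) :
    Submodule ℂ (EuclideanSpace ℂ (Fin N)) :=
  Submodule.span ℂ (Set.range fun j => WithLp.toLp 2 fun i => A i j)

/-- `inf ‖P_T a‖` over the unit vectors `a` of `S`. -/
def infProj {N : ℕ} (S T : Submodule ℂ (EuclideanSpace ℂ (Fin N))) : ℝ :=
  sInf {x : ℝ | ∃ a ∈ S, ‖a‖ = 1 ∧ x = ‖T.starProjection a‖}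

/-- The subspace angle (largest principal angle): its cosine is the infimum of `‖P a‖` over the
unit vectors `a` of the subspace of smaller dimension, `P` being the orthogonal projection onto
the other subspace. -/
def subspaceAngle {N : ℕ} (S T : Submodule ℂ (EuclideanSpace ℂ (Fin N))) : ℝ :=
  Real.arccos
    (if Module.finrank ℂ S ≤ Module.finrank ℂ T then infProj S T else infProj T S)

end

end Slepian

/-!
The Slepian vectors with eigenvalues at least `ε` lie in the range of the prolate matrix `B`, on
which `B` is inverted at the cost of a factor `1 / ε`.  As `1 - Q Q* = F̄ (1 - V V*) F̄*`, it is
enough that `(1 - V V*) F̄* B` has norm at most `ε ^ (3 / 2)`; the dominant left singular vectors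
being optimal, this follows once `‖B F̄ y‖ ≤ ε ^ (3 / 2) ‖y‖` for all `y` in a subspace of
codimension at most `R`.

To find such a subspace, write the Dirichlet kernel, which couples the frequencies `f ∈ [-W, W]` to
the nodes `x` outside this interval, in the coordinate `t = sin (π (x - α)) / sin (π (x + α))`, with
`α` slightly larger than `W`.  Up to separable factors it becomes the Cauchy kernel `1 / (a + b)`,
where `a = t(x)` and `b = -t(f)` lie in `[1 / N, N]`.  For a Blaschke product `r` of degree `k` the
kernel `(1 - r(a) r(b)) / (a + b)` has rank `k` (Christoffel–Darboux), so `k` linear conditions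
on `y` replace the Cauchy kernel by `r(a) r(b) / (a + b)`.  If the zeros of `r` form a geometric
progression then `|r| ≤ ε ^ (3 / 4)` on `[1 / N, N]` already for `k` of order `log N · log (1 / ε)`.
-/

namespace Slepian

open scoped Matrix ComplexConjugate Matrix.Norms.L2Operator

/-! ### Blaschke products on the half-line -/

section Blaschke

/-- The Blaschke product of the right half-plane with zeros `p 0, …, p (k - 1)`, on the real
axis. -/
noncomputable def blaschkeProd (p : ℕ → ℝ) (k : ℕ) (y : ℝ) : ℝ :=
  ∏ j ∈ Finset.range k, (y - p j) / (y + p j)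

/-- The `j`-th Malmquist–Takenaka function of the nodes `p`, without its normalizing factor
`√(2 p j)`.  These are the orthogonal rational functions in which the Christoffel–Darboux formula
for Blaschke products is expressed. -/
noncomputable def malmquist (p : ℕ → ℝ) (j : ℕ) (y : ℝ) : ℝ :=
  blaschkeProd p j y / (y + p j)

lemma one_sub_blaschkeProd_mul {p : ℕ → ℝ} {a b : ℝ} (ha : ∀ j, a + p j ≠ 0)
    (hb : ∀ j, b + p j ≠ 0) (k : ℕ) :
    1 - blaschkeProd p k a * blaschkeProd p k b =
      (a + b) * ∑ j ∈ Finset.range k, 2 * p j * malmquist p j a * malmquist p j b := by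
  induction k with
  | zero => simp [blaschkeProd]
  | succ k ih =>
    have succ (y : ℝ) : blaschkeProd p (k + 1) y =
        blaschkeProd p k y * ((y - p k) / (y + p k)) := Finset.prod_range_succ ..
    have factor : 1 - (a - p k) / (a + p k) * ((b - p k) / (b + p k)) =
        (a + b) * (2 * p k / (a + p k) / (b + p k)) := by
      have := ha k
      have := hb k
      field_simp
      ring
    rw [Finset.sum_range_succ, mul_add, ← ih, succ, succ, malmquist, malmquist]
    linear_combination blaschkeProd p k a * blaschkeProd p k b * factor

lemma one_sub_le_one_add_mul_exp {q : ℝ} (hq : 0 ≤ q) :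
    1 - q ≤ (1 + q) * Real.exp (-(2 * q)) := by
  rcases le_or_gt 1 q with h1 | h1
  · have : 0 ≤ (1 + q) * Real.exp (-(2 * q)) := by positivity
    linarith
  have log_sub : 2 * q ≤ Real.log (1 + q) - Real.log (1 - q) := by
    have hs := Real.hasSum_log_sub_log_of_abs_lt_one (abs_lt.2 ⟨by linarith, h1⟩)
    have := hs.tsum_eq ▸ hs.summable.le_tsum 0 fun j _ => by positivity
    simpa using this
  calc 1 - q = (1 + q) * Real.exp (-(Real.log (1 + q) - Real.log (1 - q))) := by
        rw [neg_sub, Real.exp_sub, Real.exp_log (by linarith), Real.exp_log (by linarith)]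
        field_simp
    _ ≤ (1 + q) * Real.exp (-(2 * q)) := by gcongr

lemma abs_exp_sub_exp_div_le (u t : ℝ) :
    |(Real.exp u - Real.exp t) / (Real.exp u + Real.exp t)| ≤
      Real.exp (-(2 * Real.exp (-|u - t|))) := by
  wlog h : t ≤ u generalizing u t
  · have := this t u (le_of_not_ge h)
    rwa [abs_div, abs_sub_comm, add_comm, ← abs_div, abs_sub_comm t u] at this
  have hle : Real.exp t ≤ Real.exp u := Real.exp_le_exp.2 h
  have hq : Real.exp t = Real.exp u * Real.exp (-(u - t)) := by
    rw [← Real.exp_add]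
    ring_nf
  rw [abs_of_nonneg (div_nonneg (sub_nonneg.2 hle) (by positivity)),
    abs_of_nonneg (sub_nonneg.2 h), div_le_iff₀ (by positivity), hq]
  have := mul_le_mul_of_nonneg_left
    (one_sub_le_one_add_mul_exp (Real.exp_pos (-(u - t))).le) (Real.exp_pos u).le
  linarith

/-- The distribution function of the Laplace distribution, whose density is `exp (-|s|) / 2`. -/
noncomputable def laplaceCdf (s : ℝ) : ℝ := if s ≤ 0 then Real.exp s / 2 else 1 - Real.exp (-s) / 2

lemma two_le_exp_add_exp_neg (s : ℝ) : 2 ≤ Real.exp s + Real.exp (-s) := by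
  linarith [Real.one_le_cosh s, Real.cosh_eq s]

lemma laplaceCdf_le_exp_div_two (s : ℝ) : laplaceCdf s ≤ Real.exp s / 2 := by
  unfold laplaceCdf
  split_ifs
  · rfl
  · linarith [two_le_exp_add_exp_neg s]

lemma laplaceCdf_neg (s : ℝ) : laplaceCdf (-s) = 1 - laplaceCdf s := by
  unfold laplaceCdf
  rcases lt_trichotomy s 0 with h | rfl | h
  · simp [h.le, h]
  · norm_num
  · simp [h.le, h.not_ge]

lemma laplaceCdf_add_sub_laplaceCdf_sub_le (t : ℝ) {h : ℝ} (hh : 0 ≤ h) :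
    laplaceCdf (t + h) - laplaceCdf (t - h) ≤ Real.sinh h * Real.exp (-|t|) := by
  wlog ht : t ≤ 0 generalizing t
  · have := this (-t) (by linarith)
    rw [abs_neg, neg_add_eq_sub, ← neg_sub t h, ← neg_add', laplaceCdf_neg, laplaceCdf_neg] at this
    linarith
  have left : laplaceCdf (t - h) = Real.exp (t - h) / 2 := if_pos (by linarith)
  calc laplaceCdf (t + h) - laplaceCdf (t - h)
      ≤ Real.exp (t + h) / 2 - Real.exp (t - h) / 2 := by
        rw [left]
        gcongr
        exact laplaceCdf_le_exp_div_two _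
    _ = Real.sinh h * Real.exp (-|t|) := by
        rw [abs_of_nonpos ht, neg_neg, Real.sinh_eq, sub_eq_add_neg t h, Real.exp_add, Real.exp_add]
        ring

lemma one_sub_exp_neg_le_laplaceCdf_sub {a b d : ℝ} (ha : a ≤ -d) (hb : d ≤ b) :
    1 - Real.exp (-d) ≤ laplaceCdf b - laplaceCdf a := by
  have tail {c : ℝ} (hc : c ≤ -d) : laplaceCdf c ≤ Real.exp (-d) / 2 :=
    (laplaceCdf_le_exp_div_two c).trans (by gcongr)
  have := tail (neg_le_neg hb)
  rw [laplaceCdf_neg] at this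
  linarith [tail ha]

/-- The `j`-th of the `k` midpoints of the grid of mesh `2 h` that covers `[-k h, k h]`. -/
noncomputable def gridPoint (k : ℕ) (h : ℝ) (j : ℕ) : ℝ := (2 * j + 1) * h - k * h

lemma one_sub_exp_neg_le_sum_gridPoint {k : ℕ} {h d u : ℝ} (hh : 0 ≤ h) (hk : |u| + d ≤ k * h) :
    1 - Real.exp (-d) ≤
      Real.sinh h * ∑ j ∈ Finset.range k, Real.exp (-|u - gridPoint k h j|) := by
  have hu := abs_le.1 (show |u| ≤ k * h - d by linarith)
  let edge (j : ℕ) : ℝ := 2 * j * h - k * h - u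
  calc 1 - Real.exp (-d)
      ≤ laplaceCdf (edge k) - laplaceCdf (edge 0) :=
        one_sub_exp_neg_le_laplaceCdf_sub (by simp only [edge, Nat.cast_zero]; linarith)
          (by simp only [edge]; linarith)
    _ = ∑ j ∈ Finset.range k, (laplaceCdf (edge (j + 1)) - laplaceCdf (edge j)) :=
        (Finset.sum_range_sub (fun j => laplaceCdf (edge j)) k).symm
    _ ≤ ∑ j ∈ Finset.range k, Real.sinh h * Real.exp (-|u - gridPoint k h j|) := by
        refine Finset.sum_le_sum fun j _ => ?_
        have right : edge (j + 1) = gridPoint k h j - u + h := by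
          simp only [edge, gridPoint]; push_cast; ring
        have left : edge j = gridPoint k h j - u - h := by
          simp only [edge, gridPoint]; ring
        rw [abs_sub_comm, right, left]
        exact laplaceCdf_add_sub_laplaceCdf_sub_le _ hh
    _ = Real.sinh h * ∑ j ∈ Finset.range k, Real.exp (-|u - gridPoint k h j|) :=
        (Finset.mul_sum ..).symm

lemma sinh_le_div_one_sub {x : ℝ} (hx : x < 1) : Real.sinh x ≤ x / (1 - x) := by
  have hx' : 0 < 1 - x := by linarith
  have exp_neg_ge : 1 - x ≤ Real.exp (-x) := by linarith [Real.add_one_le_exp (-x)]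
  have exp_le : Real.exp x ≤ (1 - x)⁻¹ := by
    rw [← neg_neg x, Real.exp_neg, neg_neg]
    gcongr
  have : (1 - x)⁻¹ - (1 - x) = 2 * (x / (1 - x)) - x ^ 2 / (1 - x) := by
    field_simp
    ring
  have : 0 ≤ x ^ 2 / (1 - x) := by positivity
  rw [Real.sinh_eq]
  linarith

lemma abs_blaschkeProd_exp_gridPoint_le {k : ℕ} {h d y : ℝ} (hh : 0 < h) (hh1 : h < 1)
    (hy : 0 < y) (hk : |Real.log y| + d ≤ k * h) :
    |blaschkeProd (fun j => Real.exp (gridPoint k h j)) k y| ≤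
      Real.exp (-(2 * ((1 - Real.exp (-d)) * (1 / h - 1)))) := by
  set S := ∑ j ∈ Finset.range k, Real.exp (-|Real.log y - gridPoint k h j|)
  have hS : (1 - Real.exp (-d)) * (1 / h - 1) ≤ S := by
    have hle : 1 - Real.exp (-d) ≤ h / (1 - h) * S :=
      (one_sub_exp_neg_le_sum_gridPoint hh.le hk).trans <|
        mul_le_mul_of_nonneg_right (sinh_le_div_one_sub hh1) <|
          Finset.sum_nonneg fun _ _ => (Real.exp_pos _).le
    have h1 : 0 < 1 - h := by linarith
    calc (1 - Real.exp (-d)) * (1 / h - 1)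
        ≤ h / (1 - h) * S * (1 / h - 1) :=
          mul_le_mul_of_nonneg_right hle (by rw [sub_nonneg, le_div_iff₀ hh]; linarith)
      _ = S := by field_simp
  calc |blaschkeProd (fun j => Real.exp (gridPoint k h j)) k y|
      ≤ ∏ j ∈ Finset.range k, Real.exp (-(2 * Real.exp (-|Real.log y - gridPoint k h j|))) := by
        rw [blaschkeProd, Finset.abs_prod]
        refine Finset.prod_le_prod (fun j _ => abs_nonneg _) fun j _ => ?_
        simpa only [Real.exp_log hy] using abs_exp_sub_exp_div_le (Real.log y) (gridPoint k h j)
    _ = Real.exp (-(2 * S)) := by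
        rw [← Real.exp_sum, Finset.sum_neg_distrib, Finset.mul_sum]
    _ ≤ Real.exp (-(2 * ((1 - Real.exp (-d)) * (1 / h - 1)))) := by gcongr

lemma five_halves_lt_log_fifteen : 5 / 2 < Real.log 15 := by
  have : Real.exp 5 < 15 ^ 2 :=
    calc Real.exp 5 = Real.exp 1 ^ 5 := by rw [← Real.exp_nat_mul]; norm_num
      _ < 2.7182818286 ^ 5 := by gcongr; exact Real.exp_one_lt_d9
      _ ≤ 15 ^ 2 := by norm_num
  have := (Real.lt_log_iff_exp_lt (by norm_num)).2 this
  rw [Real.log_pow] at this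
  push_cast at this
  linarith

lemma exp_neg_three_le : Real.exp (-3) ≤ 1 / 16 := by
  rw [Real.exp_neg, ← one_div]
  gcongr
  calc (16 : ℝ) ≤ 2.7182818283 ^ 3 := by norm_num
    _ ≤ Real.exp 1 ^ 3 := by gcongr; exact Real.exp_one_gt_d9.le
    _ = Real.exp 3 := by rw [← Real.exp_nat_mul]; norm_num

lemma five_halves_lt_log_fifteen_div {ε : ℝ} (hε : ε ∈ Set.Ioo (0 : ℝ) 1) :
    5 / 2 < Real.log (15 / ε) := by
  rw [Real.log_div (by norm_num) hε.1.ne']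
  linarith [five_halves_lt_log_fifteen, Real.log_neg hε.1 hε.2]

lemma exists_abs_blaschkeProd_le {ε L : ℝ} {k : ℕ} (hε : ε ∈ Set.Ioo (0 : ℝ) 1)
    (hk : 2 / 5 * (L + 3) * Real.log (15 / ε) ≤ k) :
    ∃ p : ℕ → ℝ, (∀ j, 0 < p j) ∧
      ∀ y, 0 < y → |Real.log y| ≤ L → |blaschkeProd p k y| ≤ ε ^ (3 / 4 : ℝ) := by
  set l := Real.log (15 / ε)
  have hl : 5 / 2 < l := five_halves_lt_log_fifteen_div hε
  have hl0 : 0 < l := by linarith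
  have hkh : L + 3 ≤ k * (5 / 2 / l) := by
    rw [← mul_div_assoc, le_div_iff₀ hl0]
    linarith
  refine ⟨_, fun j => Real.exp_pos (gridPoint k (5 / 2 / l) j), fun y hy hyL => ?_⟩
  refine (abs_blaschkeProd_exp_gridPoint_le (d := 3) (by positivity)
    ((div_lt_one hl0).2 hl) hy (by linarith)).trans ?_
  rw [Real.rpow_def_of_pos hε.1]
  refine Real.exp_le_exp.2 ?_
  have hlog : l = Real.log 15 - Real.log ε := Real.log_div (by norm_num) hε.1.ne'
  have hinv : 1 / (5 / 2 / l) = 2 / 5 * l := by field_simp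
  rw [hinv]
  have := mul_le_mul_of_nonneg_right (show 15 / 16 ≤ 1 - Real.exp (-3) by
    linarith [exp_neg_three_le]) (show 0 ≤ 2 / 5 * l - 1 by linarith)
  linarith [five_halves_lt_log_fifteen]

end Blaschke

/-! ### The spectral norm and dominant left singular vectors -/

section SingularVectors

variable {ι κ : Type*} [Fintype ι] [Fintype κ]

lemma norm_toLp_sq (v : ι → ℂ) : ‖WithLp.toLp 2 v‖ ^ 2 = (star v ⬝ᵥ v).re := by
  simp [EuclideanSpace.norm_sq_eq, dotProduct, Complex.conj_mul', ← Complex.ofReal_pow]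

lemma norm_toLp_mulVec_sq (A : Matrix ι κ ℂ) (v : κ → ℂ) :
    ‖WithLp.toLp 2 (A *ᵥ v)‖ ^ 2 = (star v ⬝ᵥ (Aᴴ * A) *ᵥ v).re := by
  rw [norm_toLp_sq, Matrix.star_mulVec, ← Matrix.dotProduct_mulVec, Matrix.mulVec_mulVec]

variable [DecidableEq κ]

lemma norm_toLp_mulVec_of_conjTranspose_mul_self {A : Matrix ι κ ℂ} (hA : Aᴴ * A = 1) (v : κ → ℂ) :
    ‖WithLp.toLp 2 (A *ᵥ v)‖ = ‖WithLp.toLp 2 v‖ := by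
  rw [← sq_eq_sq₀ (norm_nonneg _) (norm_nonneg _), norm_toLp_mulVec_sq, hA, Matrix.one_mulVec,
    norm_toLp_sq]

lemma norm_le_one_of_conjTranspose_mul_self {A : Matrix ι κ ℂ} (hA : Aᴴ * A = 1) : ‖A‖ ≤ 1 := by
  refine ContinuousLinearMap.opNorm_le_bound _ zero_le_one fun v => ?_
  rw [one_mul]
  exact (norm_toLp_mulVec_of_conjTranspose_mul_self hA v.ofLp).le

variable {m n r : ℕ} {A : Matrix (Fin m) (Fin n) ℂ} {V : Matrix (Fin m) (Fin r) ℂ}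

lemma IsDominantLeftSingularVectors.exists_eigenbasis (h : IsDominantLeftSingularVectors A V) :
    ∃ (hr : r ≤ m) (U : Matrix (Fin m) (Fin m) ℂ) (τ : Fin m → ℝ),
      Uᴴ * U = 1 ∧ U * Uᴴ = 1 ∧ Antitone τ ∧ (∀ i, 0 ≤ τ i) ∧
      A * Aᴴ = U * Matrix.diagonal (fun i => ((τ i ^ 2 : ℝ) : ℂ)) * Uᴴ ∧
      V = U.submatrix id (Fin.castLE hr) := by
  obtain ⟨hr, U, X, σ, hU, hX, hanti, hpos, hA, hV⟩ := h
  set S : Matrix (Fin m) (Fin n) ℂ := Matrix.of fun i j => if (i : ℕ) = j then (σ i : ℂ) else 0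
  set τ : Fin m → ℝ := fun i => if (i : ℕ) < n then σ i else 0
  have hS : S * Sᴴ = Matrix.diagonal fun i => ((τ i ^ 2 : ℝ) : ℂ) := by
    ext i i'
    rw [Matrix.mul_apply, Matrix.diagonal_apply]
    by_cases hi : (i : ℕ) < n
    · rw [Finset.sum_eq_single ⟨i, hi⟩ (fun j _ hj => ?_) (by simp)]
      · rcases eq_or_ne i i' with rfl | hii'
        · simp [S, τ, hi, sq]
        · simp [S, hii', Fin.val_ne_of_ne hii'.symm]
      · simp [S, show (i : ℕ) ≠ j from fun h => hj (Fin.ext h.symm)]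
    · rw [Finset.sum_eq_zero fun j _ => ?_]
      · simp [τ, hi]
      · simp [S, show (i : ℕ) ≠ j from fun h => hi (h ▸ j.isLt)]
  refine ⟨hr, U, τ, Matrix.mem_unitaryGroup_iff'.1 hU, Matrix.mem_unitaryGroup_iff.1 hU, ?_, ?_,
    ?_, Matrix.ext hV⟩
  · intro i j hij
    have hij' : (i : ℕ) ≤ j := hij
    simp only [τ]
    split_ifs
    · exact hanti hij'
    · omega
    · exact hpos i
    · rfl
  · intro i
    simp only [τ]
    split_ifs
    · exact hpos i
    · rfl
  · have hXX : Xᴴ * X = 1 := Matrix.mem_unitaryGroup_iff'.1 hX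
    calc A * Aᴴ = U * S * (Xᴴ * X) * (Sᴴ * Uᴴ) := by
          rw [hA]
          simp only [Matrix.conjTranspose_mul, Matrix.conjTranspose_conjTranspose, Matrix.mul_assoc]
      _ = U * (S * Sᴴ) * Uᴴ := by rw [hXX, Matrix.mul_one]; simp only [Matrix.mul_assoc]
      _ = _ := by rw [hS]

lemma IsDominantLeftSingularVectors.conjTranspose_mul_self
    (h : IsDominantLeftSingularVectors A V) : Vᴴ * V = 1 := by
  obtain ⟨hr, U, -, hU, -, -, -, -, rfl⟩ := h.exists_eigenbasis
  rw [Matrix.conjTranspose_submatrix, ← Matrix.submatrix_mul _ _ _ _ _ Function.bijective_id, hU,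
    Matrix.submatrix_one _ (Fin.castLE_injective hr)]

lemma one_sub_submatrix_castLE_mul_conjTranspose {U : Matrix (Fin m) (Fin m) ℂ} (hU : U * Uᴴ = 1)
    (hr : r ≤ m) :
    1 - U.submatrix id (Fin.castLE hr) * (U.submatrix id (Fin.castLE hr))ᴴ =
      U * Matrix.diagonal (fun i : Fin m => if r ≤ i then 1 else 0) * Uᴴ := by
  set D : Matrix (Fin m) (Fin m) ℂ := Matrix.diagonal fun i => if r ≤ i then 1 else 0
  have head : U.submatrix id (Fin.castLE hr) * (U.submatrix id (Fin.castLE hr))ᴴ =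
      U * (1 - D) * Uᴴ := by
    ext a b
    rw [← Matrix.diagonal_one, Matrix.diagonal_sub, Matrix.mul_apply, Matrix.mul_apply]
    refine Fintype.sum_of_injective _ (Fin.castLE_injective hr) _ _ (fun i hi => ?_) fun i => ?_
    · have : r ≤ i := by
        by_contra! hlt
        exact hi ⟨⟨i, hlt⟩, rfl⟩
      simp [this]
    · simp [i.isLt.not_ge]
  rw [head, Matrix.mul_sub, Matrix.mul_one, Matrix.sub_mul, hU, sub_sub_cancel]

lemma exists_ne_zero_mem_apply_eq_zero_of_lt (L : (Fin m → ℂ) →ₗ[ℂ] Fin m → ℂ)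
    {Y : Submodule ℂ (Fin m → ℂ)} {i : Fin m} (hY : m ≤ Module.finrank ℂ Y + i) :
    ∃ y ∈ Y, y ≠ 0 ∧ ∀ j, i < j → L y j = 0 := by
  let π : Y →ₗ[ℂ] ({j : Fin m // i < j} → ℂ) :=
    (LinearMap.funLeft ℂ ℂ Subtype.val) ∘ₗ L ∘ₗ Y.subtype
  have hfin : Module.finrank ℂ ({j : Fin m // i < j} → ℂ) < Module.finrank ℂ Y := by
    rw [Module.finrank_fintype_fun_eq_card, Fintype.card_subtype, Finset.filter_lt_eq_Ioi,
      Fin.card_Ioi]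
    omega
  obtain ⟨⟨y, hyY⟩, hker, hne⟩ :=
    Submodule.exists_mem_ne_zero_of_ne_bot (LinearMap.ker_ne_bot_of_finrank_lt (f := π) hfin)
  exact ⟨y, hyY, fun h => hne (Subtype.ext h), fun j hj => congrFun hker ⟨j, hj⟩⟩

lemma norm_conjTranspose_mulVec_sq {U : Matrix (Fin m) (Fin m) ℂ} {τ : Fin m → ℝ}
    (hA : A * Aᴴ = U * Matrix.diagonal (fun i => ((τ i ^ 2 : ℝ) : ℂ)) * Uᴴ) (y : Fin m → ℂ) :
    ‖WithLp.toLp 2 (Aᴴ *ᵥ y)‖ ^ 2 = ∑ j, τ j ^ 2 * ‖(Uᴴ *ᵥ y) j‖ ^ 2 := by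
  set E : Matrix (Fin m) (Fin m) ℂ := Matrix.diagonal fun j => (τ j : ℂ)
  have hE : Matrix.diagonal (fun i => ((τ i ^ 2 : ℝ) : ℂ)) = Eᴴ * E := by
    simp [E, Matrix.diagonal_conjTranspose, sq]
  have gram : A * Aᴴ = (E * Uᴴ)ᴴ * (E * Uᴴ) := by
    rw [hA, hE]
    simp only [Matrix.conjTranspose_mul, Matrix.conjTranspose_conjTranspose, Matrix.mul_assoc]
  calc ‖WithLp.toLp 2 (Aᴴ *ᵥ y)‖ ^ 2 = ‖WithLp.toLp 2 ((E * Uᴴ) *ᵥ y)‖ ^ 2 := by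
        rw [norm_toLp_mulVec_sq, norm_toLp_mulVec_sq, Matrix.conjTranspose_conjTranspose, gram]
    _ = ∑ j, τ j ^ 2 * ‖(Uᴴ *ᵥ y) j‖ ^ 2 := by
        simp [← Matrix.mulVec_mulVec, E, EuclideanSpace.norm_sq_eq, Matrix.mulVec_diagonal, mul_pow]

lemma le_of_norm_conjTranspose_mulVec_le {U : Matrix (Fin m) (Fin m) ℂ} {τ : Fin m → ℝ}
    (hU : U * Uᴴ = 1) (hanti : Antitone τ) (hpos : ∀ i, 0 ≤ τ i)
    (hA : A * Aᴴ = U * Matrix.diagonal (fun i => ((τ i ^ 2 : ℝ) : ℂ)) * Uᴴ)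
    {Y : Submodule ℂ (Fin m → ℂ)} {i : Fin m} (hY : m ≤ Module.finrank ℂ Y + i) {δ : ℝ}
    (hδ : ∀ y ∈ Y, ‖WithLp.toLp 2 (Aᴴ *ᵥ y)‖ ≤ δ * ‖WithLp.toLp 2 y‖) : τ i ≤ δ := by
  obtain ⟨y, hyY, hy0, hyi⟩ := exists_ne_zero_mem_apply_eq_zero_of_lt (Matrix.mulVecLin Uᴴ) hY
  set w := Uᴴ *ᵥ y
  have norm_w : ‖WithLp.toLp 2 w‖ = ‖WithLp.toLp 2 y‖ :=
    norm_toLp_mulVec_of_conjTranspose_mul_self (by simpa using hU) y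
  have norm_Ay : ‖WithLp.toLp 2 (Aᴴ *ᵥ y)‖ ^ 2 = ∑ j, τ j ^ 2 * ‖w j‖ ^ 2 :=
    norm_conjTranspose_mulVec_sq hA y
  have lower : (τ i * ‖WithLp.toLp 2 y‖) ^ 2 ≤ ‖WithLp.toLp 2 (Aᴴ *ᵥ y)‖ ^ 2 := by
    rw [norm_Ay, mul_pow, ← norm_w, EuclideanSpace.norm_sq_eq, Finset.mul_sum]
    refine Finset.sum_le_sum fun j _ => ?_
    rcases lt_or_ge i j with hij | hij
    · simp [show w j = 0 from hyi j hij]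
    · have := hpos i
      gcongr
      exact hanti hij
  have hy : 0 < ‖WithLp.toLp 2 y‖ := by simpa using hy0
  exact le_of_mul_le_mul_right
    ((abs_le_of_sq_le_sq' lower (norm_nonneg _)).2.trans (hδ y hyY)) hy

lemma norm_conj_diagonal_mul_sq_le {U D T : Matrix (Fin m) (Fin m) ℂ} (hU : Uᴴ * U = 1)
    (hA : A * Aᴴ = U * T * Uᴴ) : ‖U * D * Uᴴ * A‖ ^ 2 ≤ ‖D * T * Dᴴ‖ := by
  have gram : U * D * Uᴴ * A * (U * D * Uᴴ * A)ᴴ = U * (D * T * Dᴴ) * Uᴴ :=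
    calc _ = U * D * Uᴴ * (A * Aᴴ) * (U * D * Uᴴ)ᴴ := by
          rw [Matrix.conjTranspose_mul _ A]
          simp only [Matrix.mul_assoc]
      _ = U * D * (Uᴴ * U) * T * (Uᴴ * U) * Dᴴ * Uᴴ := by
          rw [hA]
          simp only [Matrix.conjTranspose_mul, Matrix.conjTranspose_conjTranspose, Matrix.mul_assoc]
      _ = _ := by
          rw [hU]
          simp only [Matrix.mul_one, Matrix.mul_assoc]
  have norm_U : ‖U‖ ≤ 1 := norm_le_one_of_conjTranspose_mul_self hU
  calc ‖U * D * Uᴴ * A‖ ^ 2 = ‖U * (D * T * Dᴴ) * Uᴴ‖ := by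
        rw [← gram, ← Matrix.l2_opNorm_conjTranspose, sq, ← Matrix.l2_opNorm_conjTranspose_mul_self,
          Matrix.conjTranspose_conjTranspose]
    _ ≤ ‖U‖ * ‖D * T * Dᴴ‖ * ‖Uᴴ‖ :=
        (Matrix.l2_opNorm_mul _ _).trans (by gcongr; exact Matrix.l2_opNorm_mul _ _)
    _ ≤ 1 * ‖D * T * Dᴴ‖ * 1 := by
        rw [Matrix.l2_opNorm_conjTranspose]
        gcongr
    _ = ‖D * T * Dᴴ‖ := by ring

lemma IsDominantLeftSingularVectors.norm_one_sub_mul_le (h : IsDominantLeftSingularVectors A V)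
    {Y : Submodule ℂ (Fin m → ℂ)} (hY : m ≤ Module.finrank ℂ Y + r) {δ : ℝ} (hδ0 : 0 ≤ δ)
    (hδ : ∀ y ∈ Y, ‖WithLp.toLp 2 (Aᴴ *ᵥ y)‖ ≤ δ * ‖WithLp.toLp 2 y‖) :
    ‖(1 - V * Vᴴ) * A‖ ≤ δ := by
  obtain ⟨hr, U, τ, hUU, hU, hanti, hpos, hA, rfl⟩ := h.exists_eigenbasis
  rw [one_sub_submatrix_castLE_mul_conjTranspose hU]
  refine abs_le_of_sq_le_sq' ((norm_conj_diagonal_mul_sq_le hUU hA).trans ?_) hδ0 |>.2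
  rw [Matrix.diagonal_conjTranspose, Matrix.diagonal_mul_diagonal, Matrix.diagonal_mul_diagonal,
    Matrix.l2_opNorm_diagonal, pi_norm_le_iff_of_nonneg (by positivity)]
  intro i
  by_cases hi : r ≤ i
  · have hτ : τ i ≤ δ := le_of_norm_conjTranspose_mulVec_le hU hanti hpos hA (by omega) hδ
    simpa [hi] using pow_le_pow_left₀ (hpos i) hτ 2
  · simp [hi, sq_nonneg]

end SingularVectors

/-! ### The prolate matrix -/

section Prolate

open scoped ComplexOrder

variable {N : ℕ} {W : ℝ}

/-- The discrete-time Fourier transform of the signal that equals `z` on `{0, …, N - 1}` and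
vanishes elsewhere. -/
noncomputable def dtftVec (z : Fin N → ℂ) (f : ℝ) : ℂ := star (expVec N f) ⬝ᵥ z

lemma expVec_mul_conj_expVec (x f : ℝ) (m n : Fin N) :
    expVec N x m * conj (expVec N f n) =
      Complex.exp (2 * Real.pi * Complex.I * (x * (m : ℕ) - f * (n : ℕ))) := by
  rw [expVec, expVec, ← Complex.exp_conj, ← Complex.exp_add]
  congr 1
  simp only [map_mul, map_ofNat, Complex.conj_ofReal, Complex.conj_I, map_natCast]
  ring

@[fun_prop]
lemma continuous_expVec (m : Fin N) : Continuous fun f => expVec N f m := by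
  unfold expVec
  fun_prop

@[fun_prop]
lemma continuous_dtftVec (z : Fin N → ℂ) : Continuous (dtftVec z) := by
  change Continuous fun f => ∑ n, star (expVec N f n) * z n
  fun_prop

lemma integral_exp_eq_sin_div {c : ℝ} (hc : c ≠ 0) :
    ∫ f in (-W)..W, Complex.exp ((2 * Real.pi * Complex.I * c) * f) =
      ((Real.sin (2 * Real.pi * W * c) / (Real.pi * c) : ℝ) : ℂ) := by
  have hπ : (Real.pi : ℂ) ≠ 0 := by exact_mod_cast Real.pi_ne_zero
  have hc' : (c : ℂ) ≠ 0 := by exact_mod_cast hc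
  have pos_arg : 2 * (Real.pi : ℂ) * Complex.I * c * W = (2 * Real.pi * W * c) * Complex.I := by
    ring
  have neg_arg : 2 * (Real.pi : ℂ) * Complex.I * c * -W = -(2 * Real.pi * W * c) * Complex.I := by
    ring
  rw [integral_exp_mul_complex (by simp [hc, Real.pi_ne_zero])]
  push_cast
  rw [Complex.sin, pos_arg, neg_arg]
  field_simp
  rw [Complex.I_sq]
  ring

lemma integral_expVec_mul_conj_expVec (m n : Fin N) :
    ∫ f in (-W)..W, expVec N f m * conj (expVec N f n) = prolate N W m n := by
  have arg (f : ℝ) : 2 * Real.pi * Complex.I * (f * (m : ℕ) - f * (n : ℕ)) =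
      (2 * Real.pi * Complex.I * (((m : ℕ) : ℝ) - ((n : ℕ) : ℝ) : ℝ)) * f := by
    push_cast
    ring
  simp_rw [expVec_mul_conj_expVec, arg]
  by_cases h : m = n
  · subst h
    simp [prolate, two_mul]
  · rw [integral_exp_eq_sin_div (sub_ne_zero.2 fun h' => h (Fin.ext (by exact_mod_cast h')))]
    simp [prolate, h]

lemma prolate_mulVec_apply (z : Fin N → ℂ) (m : Fin N) :
    (prolate N W *ᵥ z) m = ∫ f in (-W)..W, expVec N f m * dtftVec z f := by
  have expand (f : ℝ) : expVec N f m * dtftVec z f =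
      ∑ n, expVec N f m * conj (expVec N f n) * z n := by
    simp only [dtftVec, dotProduct, Finset.mul_sum, Pi.star_apply, RCLike.star_def, mul_assoc]
  simp_rw [expand]
  rw [intervalIntegral.integral_finsetSum fun n _ =>
    Continuous.intervalIntegrable (by fun_prop) _ _]
  simp only [intervalIntegral.integral_mul_const, integral_expVec_mul_conj_expVec, Matrix.mulVec,
    dotProduct]

lemma dotProduct_prolate_mulVec (z : Fin N → ℂ) :
    star z ⬝ᵥ prolate N W *ᵥ z = ((∫ f in (-W)..W, ‖dtftVec z f‖ ^ 2 : ℝ) : ℂ) := by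
  have expand (f : ℝ) : ((‖dtftVec z f‖ ^ 2 : ℝ) : ℂ) =
      ∑ m, star (z m) * (expVec N f m * dtftVec z f) := by
    rw [Complex.ofReal_pow, ← Complex.conj_mul', dtftVec, dotProduct, map_sum, Finset.sum_mul]
    simp [mul_assoc, mul_left_comm]
  rw [← intervalIntegral.integral_ofReal]
  simp_rw [expand]
  rw [intervalIntegral.integral_finsetSum fun n _ =>
    Continuous.intervalIntegrable (by fun_prop) _ _]
  simp only [dotProduct, intervalIntegral.integral_const_mul, prolate_mulVec_apply, Pi.star_apply]

lemma prolate_half : prolate N (1 / 2) = 1 := by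
  ext m n
  by_cases h : m = n
  · subst h
    simp [prolate]
  · have : Real.sin (2 * Real.pi * (1 / 2) * (((m : ℕ) : ℝ) - ((n : ℕ) : ℝ))) = 0 :=
      Real.sin_eq_zero_iff.2 ⟨(m : ℕ) - (n : ℕ), by push_cast; ring⟩
    simp only [prolate, Matrix.of_apply, h, if_false, this, zero_div, Matrix.one_apply_ne h,
      Complex.ofReal_zero]

variable (N W) in
lemma isHermitian_prolate : (prolate N W).IsHermitian := by
  ext m n
  rw [Matrix.conjTranspose_apply]
  by_cases h : m = n
  · simp [prolate, h]
  · simp only [prolate, Matrix.of_apply, h, Ne.symm h, if_false, RCLike.star_def,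
      Complex.conj_ofReal]
    rw [← neg_sub, mul_neg, mul_neg, Real.sin_neg, neg_div_neg_eq]

lemma posSemidef_prolate (hW : 0 ≤ W) : (prolate N W).PosSemidef := by
  refine Matrix.posSemidef_iff_dotProduct_mulVec.2 ⟨isHermitian_prolate N W, fun z => ?_⟩
  rw [dotProduct_prolate_mulVec, Complex.zero_le_real]
  exact intervalIntegral.integral_nonneg (by linarith) fun f _ => by positivity

lemma posSemidef_one_sub_prolate (hW0 : 0 ≤ W) (hW : W ≤ 1 / 2) :
    (1 - prolate N W).PosSemidef := by
  refine Matrix.posSemidef_iff_dotProduct_mulVec.2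
    ⟨Matrix.isHermitian_one.sub (isHermitian_prolate N W), fun z => ?_⟩
  rw [← prolate_half, Matrix.sub_mulVec, dotProduct_sub, dotProduct_prolate_mulVec,
    dotProduct_prolate_mulVec, sub_nonneg, Complex.real_le_real]
  exact intervalIntegral.integral_mono_interval (by linarith) (by linarith) hW
    (Filter.Eventually.of_forall fun f => by positivity)
    (Continuous.intervalIntegrable (by fun_prop) _ _)

lemma posSemidef_sub_mul_self {n : Type*} [Fintype n] [DecidableEq n] {B : Matrix n n ℂ}
    (hB : B.PosSemidef) (hB1 : (1 - B).PosSemidef) : (B - B * B).PosSemidef := by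
  have split : B - B * B = B * (1 - B) * Bᴴ + (1 - B) * B * (1 - B)ᴴ := by
    rw [hB.isHermitian.eq, hB1.isHermitian.eq]
    noncomm_ring
  rw [split]
  exact (hB1.mul_mul_conjTranspose_same B).add (hB.mul_mul_conjTranspose_same (1 - B))

lemma norm_prolate_mulVec_sq_le (hW0 : 0 ≤ W) (hW : W ≤ 1 / 2) (z : Fin N → ℂ) :
    ‖WithLp.toLp 2 (prolate N W *ᵥ z)‖ ^ 2 ≤ ∫ f in (-W)..W, ‖dtftVec z f‖ ^ 2 := by
  have nonneg := (posSemidef_sub_mul_self (posSemidef_prolate hW0)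
    (posSemidef_one_sub_prolate hW0 hW)).dotProduct_mulVec_nonneg z
  rw [Matrix.sub_mulVec, dotProduct_sub, dotProduct_prolate_mulVec, sub_nonneg] at nonneg
  rw [norm_toLp_mulVec_sq, (isHermitian_prolate N W).eq]
  exact (Complex.le_def.1 nonneg).1

lemma integral_norm_dtftVec_sq_le (hW0 : 0 ≤ W) (hW : W ≤ 1 / 2) (z : Fin N → ℂ) :
    ∫ f in (-W)..W, ‖dtftVec z f‖ ^ 2 ≤ ‖WithLp.toLp 2 z‖ ^ 2 := by
  have nonneg := (posSemidef_one_sub_prolate hW0 hW).dotProduct_mulVec_nonneg z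
  rw [Matrix.sub_mulVec, dotProduct_sub, dotProduct_prolate_mulVec, sub_nonneg,
    Matrix.one_mulVec] at nonneg
  rw [norm_toLp_sq]
  exact (Complex.le_def.1 nonneg).1

lemma norm_prolate_mulVec_le_of_norm_dtftVec_le (hW0 : 0 ≤ W) (hW : W ≤ 1 / 2) {δ : ℝ}
    (hδ : 0 ≤ δ) {z w : Fin N → ℂ}
    (hzw : ∀ f ∈ Set.Icc (-W) W, ‖dtftVec z f‖ ≤ δ * ‖dtftVec w f‖) :
    ‖WithLp.toLp 2 (prolate N W *ᵥ z)‖ ≤ δ * ‖WithLp.toLp 2 w‖ := by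
  refine abs_le_of_sq_le_sq' ?_ (by positivity) |>.2
  calc ‖WithLp.toLp 2 (prolate N W *ᵥ z)‖ ^ 2
      ≤ ∫ f in (-W)..W, ‖dtftVec z f‖ ^ 2 := norm_prolate_mulVec_sq_le hW0 hW z
    _ ≤ ∫ f in (-W)..W, δ ^ 2 * ‖dtftVec w f‖ ^ 2 :=
        intervalIntegral.integral_mono_on (by linarith)
          (Continuous.intervalIntegrable (by fun_prop) _ _)
          (Continuous.intervalIntegrable (by fun_prop) _ _) fun f hf => by
            rw [← mul_pow]
            gcongr
            exact hzw f hf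
    _ ≤ δ ^ 2 * ‖WithLp.toLp 2 w‖ ^ 2 := by
        rw [intervalIntegral.integral_const_mul]
        gcongr
        exact integral_norm_dtftVec_sq_le hW0 hW w
    _ = (δ * ‖WithLp.toLp 2 w‖) ^ 2 := (mul_pow ..).symm

end Prolate

/-! ### The discrete Fourier basis -/

section DFT

variable {N : ℕ} {W : ℝ}

/-- The factor depending on `f` in the closed form of the Dirichlet kernel `⟨e_f, e_x⟩` at the
nodes `x` with `N x ∈ ℤ`. -/
noncomputable def dirichletFactor (N : ℕ) (f : ℝ) : ℂ :=
  Complex.exp (Real.pi * Complex.I * f) *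
    (Complex.exp (-(2 * Real.pi * Complex.I * f * N)) - 1) / (2 * Complex.I)

lemma dtftVec_expVec_eq_geom_sum (x f : ℝ) :
    dtftVec (expVec N x) f =
      ∑ m ∈ Finset.range N, Complex.exp (2 * Real.pi * Complex.I * (x - f)) ^ m := by
  rw [dtftVec, dotProduct, Finset.sum_range]
  refine Finset.sum_congr rfl fun m _ => ?_
  rw [Pi.star_apply, RCLike.star_def, mul_comm, expVec_mul_conj_expVec, ← Complex.exp_nat_mul]
  ring_nf

lemma dtftVec_expVec_mul_sin {x : ℝ} {k : ℤ} (hx : N * x = k) (f : ℝ) :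
    dtftVec (expVec N x) f * Real.sin (Real.pi * (x - f)) =
      Complex.exp (-(Real.pi * Complex.I * x)) * dirichletFactor N f := by
  set w := Complex.exp (2 * Real.pi * Complex.I * (x - f)) with hw
  set h := Complex.exp (-(Real.pi * Complex.I * x)) * Complex.exp (Real.pi * Complex.I * f) with hh
  have pow_eq : w ^ N = Complex.exp (-(2 * Real.pi * Complex.I * f * N)) := by
    rw [hw, ← Complex.exp_nat_mul, Complex.exp_eq_exp_iff_exists_int]
    refine ⟨k, ?_⟩
    rw [← Complex.ofReal_intCast k, ← hx]
    push_cast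
    ring
  have sin_eq : (Real.sin (Real.pi * (x - f)) : ℂ) = h * (w - 1) / (2 * Complex.I) := by
    have pos_arg : -(Real.pi * Complex.I * x) + Real.pi * Complex.I * f +
        2 * Real.pi * Complex.I * (x - f) = Real.pi * (x - f) * Complex.I := by ring
    have neg_arg : -(Real.pi * Complex.I * x) + Real.pi * Complex.I * f =
        -(Real.pi * (x - f)) * Complex.I := by ring
    push_cast
    rw [Complex.sin, hh, hw, ← Complex.exp_add, mul_sub_one, ← Complex.exp_add, pos_arg, neg_arg]
    field_simp
    rw [Complex.I_sq]
    ring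
  rw [dtftVec_expVec_eq_geom_sum, ← hw, sin_eq, dirichletFactor, ← pow_eq, ← geom_sum_mul, hh]
  ring

lemma dtftVec_expVec_self (x : ℝ) : dtftVec (expVec N x) x = N := by
  simp [dtftVec_expVec_eq_geom_sum]

lemma dtftVec_expVec_div_eq_zero (hN : 0 < N) {a b : ℤ} (hab : (a : ZMod N) ≠ b) :
    dtftVec (expVec N (a / N)) (b / N) = 0 := by
  have hN' : (N : ℝ) ≠ 0 := by positivity
  have hNc : (N : ℂ) ≠ 0 := by exact_mod_cast hN.ne'
  have factor_eq_zero : dirichletFactor N (b / N) = 0 := by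
    have : Complex.exp (-(2 * Real.pi * Complex.I * ((b / N : ℝ) : ℂ) * N)) = 1 :=
      Complex.exp_eq_one_iff.2 ⟨-b, by push_cast; field_simp⟩
    rw [dirichletFactor, this, sub_self, mul_zero, zero_div]
  have prod_eq_zero := dtftVec_expVec_mul_sin (x := a / N) (mul_div_cancel₀ (a : ℝ) hN') (b / N)
  rw [factor_eq_zero, mul_zero] at prod_eq_zero
  refine (mul_eq_zero.1 prod_eq_zero).resolve_right fun sin_eq_zero => hab ?_
  obtain ⟨n, hn⟩ := Real.sin_eq_zero_iff.1 (Complex.ofReal_eq_zero.1 sin_eq_zero)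
  have sub_eq : a - b = N * n := by
    field_simp at hn
    rw [mul_comm]
    exact_mod_cast hn.symm
  exact ((ZMod.intCast_eq_intCast_iff_dvd_sub b a N).2 ⟨n, sub_eq⟩).symm

/-- The matrix whose columns are the normalized discrete Fourier vectors of frequencies
`k j / N`. -/
noncomputable def dftMatrix {ι : Type*} (N : ℕ) (k : ι → ℤ) : Matrix (Fin N) ι ℂ :=
  Matrix.of fun m j => ((1 / √(N : ℝ) : ℝ) : ℂ) * expVec N (k j / N) m

lemma dftMatrix_conjTranspose_mul_self {ι : Type*} [DecidableEq ι] (hN : 0 < N) {k : ι → ℤ}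
    (hk : Function.Injective fun j => (k j : ZMod N)) :
    (dftMatrix N k)ᴴ * dftMatrix N k = 1 := by
  have hN' : (N : ℂ) ≠ 0 := by exact_mod_cast hN.ne'
  have sq_eq : ((1 / √(N : ℝ) : ℝ) : ℂ) * ((1 / √(N : ℝ) : ℝ) : ℂ) = 1 / N := by
    rw [← Complex.ofReal_mul, div_mul_div_comm, Real.mul_self_sqrt (by positivity)]
    simp
  ext i j
  have entry_eq : ((dftMatrix N k)ᴴ * dftMatrix N k) i j =
      1 / N * dtftVec (expVec N (k j / N)) (k i / N) := by
    rw [← sq_eq, dtftVec, dotProduct, Finset.mul_sum, Matrix.mul_apply]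
    refine Finset.sum_congr rfl fun m _ => ?_
    simp only [dftMatrix, Matrix.conjTranspose_apply, Matrix.of_apply, Pi.star_apply,
      RCLike.star_def, map_mul, Complex.conj_ofReal]
    ring
  rw [entry_eq]
  rcases eq_or_ne i j with rfl | hij
  · rw [dtftVec_expVec_self, one_div_mul_cancel hN', Matrix.one_apply_eq]
  · rw [dtftVec_expVec_div_eq_zero hN (hk.ne hij.symm), mul_zero, Matrix.one_apply_ne hij]

/-- `N` times the frequencies of the columns of `lowDFT N W`. -/
noncomputable def lowFreq (N : ℕ) (W : ℝ) (j : Fin (2 * ⌊(N : ℝ) * W⌋₊ + 1)) : ℤ :=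
  j - ⌊(N : ℝ) * W⌋₊

/-- `N` times the frequencies of the columns of `highDFT N W`. -/
noncomputable def highFreq (N : ℕ) (W : ℝ) (j : Fin (numHigh N W)) : ℤ := ⌊(N : ℝ) * W⌋₊ + 1 + j

lemma fromCols_lowDFT_highDFT :
    Matrix.fromCols (lowDFT N W) (highDFT N W) =
      dftMatrix N (Sum.elim (lowFreq N W) (highFreq N W)) := by
  ext m (j | j) <;> simp [lowDFT, highDFT, lowFreq, highFreq, dftMatrix]

lemma card_lowFreq_add_numHigh (hN : 0 < N) (hW0 : 0 ≤ W) (hW : W < 1 / 2) :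
    2 * ⌊(N : ℝ) * W⌋₊ + 1 + numHigh N W = N := by
  have hN' : (0 : ℝ) < N := by exact_mod_cast hN
  have two_mul_floor_lt : 2 * (⌊(N : ℝ) * W⌋₊ : ℝ) < N := by
    nlinarith [Nat.floor_le (show 0 ≤ (N : ℝ) * W by positivity)]
  have : 2 * ⌊(N : ℝ) * W⌋₊ < N := by exact_mod_cast two_mul_floor_lt
  unfold numHigh
  lia

lemma injective_cast_sumElim_lowFreq_highFreq (hN : 0 < N) (hW0 : 0 ≤ W) (hW : W < 1 / 2) :
    Function.Injective fun j => ((Sum.elim (lowFreq N W) (highFreq N W) j : ℤ) : ZMod N) := by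
  have card_eq := card_lowFreq_add_numHigh hN hW0 hW
  intro i j hij
  obtain ⟨n, hn⟩ := (ZMod.intCast_eq_intCast_iff_dvd_sub _ _ N).1 hij
  have sub_lt : |N * n| < (N : ℤ) * 1 := by
    rw [← hn, abs_lt]
    rcases i with ⟨i, hi⟩ | ⟨i, hi⟩ <;> rcases j with ⟨j, hj⟩ | ⟨j, hj⟩ <;>
      simp only [Sum.elim_inl, Sum.elim_inr, lowFreq, highFreq] <;> lia
  rw [abs_mul, Nat.abs_cast] at sub_lt
  obtain rfl : n = 0 := Int.abs_lt_one_iff.1 (lt_of_mul_lt_mul_left sub_lt (by positivity))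
  rcases i with ⟨i, hi⟩ | ⟨i, hi⟩ <;> rcases j with ⟨j, hj⟩ | ⟨j, hj⟩ <;>
    simp only [Sum.elim_inl, Sum.elim_inr, lowFreq, highFreq, Sum.inl.injEq, Sum.inr.injEq,
      reduceCtorEq, Fin.mk.injEq] at hn ⊢ <;> lia

lemma fromCols_dft_conjTranspose_mul_self (hN : 0 < N) (hW0 : 0 ≤ W) (hW : W < 1 / 2) :
    (Matrix.fromCols (lowDFT N W) (highDFT N W))ᴴ *
      Matrix.fromCols (lowDFT N W) (highDFT N W) = 1 := by
  rw [fromCols_lowDFT_highDFT]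
  exact dftMatrix_conjTranspose_mul_self hN (injective_cast_sumElim_lowFreq_highFreq hN hW0 hW)

lemma fromCols_dft_mul_conjTranspose (hN : 0 < N) (hW0 : 0 ≤ W) (hW : W < 1 / 2) :
    Matrix.fromCols (lowDFT N W) (highDFT N W) *
      (Matrix.fromCols (lowDFT N W) (highDFT N W))ᴴ = 1 := by
  let e : Fin N ≃ Fin (2 * ⌊(N : ℝ) * W⌋₊ + 1) ⊕ Fin (numHigh N W) :=
    (finSumFinEquiv.trans (finCongr (card_lowFreq_add_numHigh hN hW0 hW))).symm
  exact (Matrix.mul_eq_one_comm_of_equiv e).2 (fromCols_dft_conjTranspose_mul_self hN hW0 hW)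

lemma fromCols_conjTranspose_mul_self_eq_one_iff {m n p : Type*} [Fintype m] [DecidableEq n]
    [DecidableEq p] {A : Matrix m n ℂ} {B : Matrix m p ℂ} :
    (Matrix.fromCols A B)ᴴ * Matrix.fromCols A B = 1 ↔
      Aᴴ * A = 1 ∧ Aᴴ * B = 0 ∧ Bᴴ * A = 0 ∧ Bᴴ * B = 1 := by
  rw [Matrix.conjTranspose_fromCols_eq_fromRows_conjTranspose, Matrix.fromRows_mul_fromCols,
    ← Matrix.fromBlocks_one, Matrix.fromBlocks_inj]

lemma highDFT_conjTranspose_mul_self (hN : 0 < N) (hW0 : 0 ≤ W) (hW : W < 1 / 2) :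
    (highDFT N W)ᴴ * highDFT N W = 1 :=
  (fromCols_conjTranspose_mul_self_eq_one_iff.1
    (fromCols_dft_conjTranspose_mul_self hN hW0 hW)).2.2.2

lemma roast_conjTranspose_mul_self (hN : 0 < N) (hW0 : 0 ≤ W) (hW : W < 1 / 2) {r : ℕ}
    {V : Matrix (Fin (numHigh N W)) (Fin r) ℂ} (hV : Vᴴ * V = 1) :
    (roast N W V)ᴴ * roast N W V = 1 := by
  obtain ⟨low_low, low_high, high_low, high_high⟩ := fromCols_conjTranspose_mul_self_eq_one_iff.1
    (fromCols_dft_conjTranspose_mul_self hN hW0 hW)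
  refine fromCols_conjTranspose_mul_self_eq_one_iff.2 ⟨low_low, ?_, ?_, ?_⟩
  · rw [← Matrix.mul_assoc, low_high, Matrix.zero_mul]
  · rw [Matrix.conjTranspose_mul, Matrix.mul_assoc, high_low, Matrix.mul_zero]
  · rw [Matrix.conjTranspose_mul, Matrix.mul_assoc, ← Matrix.mul_assoc (highDFT N W)ᴴ, high_high,
      Matrix.one_mul, hV]

lemma one_sub_roast_mul_conjTranspose (hN : 0 < N) (hW0 : 0 ≤ W) (hW : W < 1 / 2) {r : ℕ}
    (V : Matrix (Fin (numHigh N W)) (Fin r) ℂ) :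
    1 - roast N W V * (roast N W V)ᴴ = highDFT N W * ((1 - V * Vᴴ) * (highDFT N W)ᴴ) := by
  rw [← fromCols_dft_mul_conjTranspose hN hW0 hW, roast,
    Matrix.conjTranspose_fromCols_eq_fromRows_conjTranspose,
    Matrix.conjTranspose_fromCols_eq_fromRows_conjTranspose, Matrix.fromCols_mul_fromRows,
    Matrix.fromCols_mul_fromRows, Matrix.conjTranspose_mul, Matrix.sub_mul, Matrix.mul_sub,
    Matrix.one_mul]
  simp only [Matrix.mul_assoc]
  abel

end DFT

/-! ### Compression of the high-frequency part of the prolate matrix -/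

section KeyEstimate

variable {N : ℕ} {W : ℝ}

/-- The Möbius coordinate `sin (π (t - α)) / sin (π (t + α))` on the circle `ℝ / ℤ`, which is
positive for `α < t < 1 - α` and negative for `|t| < α`. -/
noncomputable def sinRatio (α t : ℝ) : ℝ :=
  Real.sin (Real.pi * (t - α)) / Real.sin (Real.pi * (t + α))

lemma sinRatio_sub_sinRatio {α x f : ℝ} (hx : Real.sin (Real.pi * (x + α)) ≠ 0)
    (hf : Real.sin (Real.pi * (f + α)) ≠ 0) :
    sinRatio α x - sinRatio α f = Real.sin (2 * (Real.pi * α)) * Real.sin (Real.pi * (x - f)) /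
      (Real.sin (Real.pi * (x + α)) * Real.sin (Real.pi * (f + α))) := by
  rw [sinRatio, sinRatio, div_sub_div _ _ hx hf]
  congr 1
  simp only [mul_sub, mul_add, Real.sin_sub, Real.sin_add, Real.sin_two_mul]
  ring

lemma two_mul_le_sin_pi_mul {δ t : ℝ} (hδ : 0 ≤ δ) (ht : t ∈ Set.Icc δ (1 - δ)) :
    2 * δ ≤ Real.sin (Real.pi * t) := by
  have first_half {u : ℝ} (hu : δ ≤ u) (hu' : u ≤ 1 / 2) : 2 * δ ≤ Real.sin (Real.pi * u) := by
    have jordan : 2 / Real.pi * (Real.pi * u) ≤ Real.sin (Real.pi * u) :=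
      Real.mul_le_sin (mul_nonneg Real.pi_pos.le (hδ.trans hu)) (by nlinarith [Real.pi_pos])
    rw [← mul_assoc, div_mul_cancel₀ _ Real.pi_ne_zero] at jordan
    linarith
  rcases le_total t (1 / 2) with h | h
  · exact first_half ht.1 h
  · rw [← Real.sin_pi_sub, ← mul_one_sub]
    exact first_half (by linarith [ht.2]) (by linarith)

lemma abs_log_div_le {c a b : ℝ} (hc : 0 < c) (ha : a ∈ Set.Icc c 1) (hb : b ∈ Set.Icc c 1) :
    |Real.log (a / b)| ≤ -Real.log c := by
  have ha0 := hc.trans_le ha.1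
  have hb0 := hc.trans_le hb.1
  rw [Real.log_div ha0.ne' hb0.ne', abs_le]
  constructor <;>
    linarith [Real.log_le_log hc ha.1, Real.log_le_log hc hb.1, Real.log_nonpos ha0.le ha.2,
      Real.log_nonpos hb0.le hb.2]

lemma sin_div_sin_pos_and_abs_log_le {δ t u : ℝ} (hδ : 0 < δ) (ht : t ∈ Set.Icc δ (1 - δ))
    (hu : u ∈ Set.Icc δ (1 - δ)) :
    0 < Real.sin (Real.pi * t) / Real.sin (Real.pi * u) ∧
      |Real.log (Real.sin (Real.pi * t) / Real.sin (Real.pi * u))| ≤ -Real.log (2 * δ) := by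
  have sin_t := two_mul_le_sin_pi_mul hδ.le ht
  have sin_u := two_mul_le_sin_pi_mul hδ.le hu
  exact ⟨div_pos (by linarith) (by linarith), abs_log_div_le (by positivity)
    ⟨sin_t, Real.sin_le_one _⟩ ⟨sin_u, Real.sin_le_one _⟩⟩

lemma sinRatio_pos_and_abs_log_le {δ α x : ℝ} (hδ : 0 < δ) (hα : 0 ≤ α)
    (hx : x ∈ Set.Icc (α + δ) (1 - α - δ)) :
    0 < sinRatio α x ∧ |Real.log (sinRatio α x)| ≤ -Real.log (2 * δ) :=
  sin_div_sin_pos_and_abs_log_le hδ ⟨by linarith [hx.1], by linarith [hx.2]⟩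
    ⟨by linarith [hx.1], by linarith [hx.2]⟩

lemma neg_sinRatio_pos_and_abs_log_le {δ α f : ℝ} (hδ : 0 < δ) (hα : α ≤ 1 / 2)
    (hf : f ∈ Set.Icc (-(α - δ)) (α - δ)) :
    0 < -sinRatio α f ∧ |Real.log (-sinRatio α f)| ≤ -Real.log (2 * δ) := by
  have neg_eq : -sinRatio α f =
      Real.sin (Real.pi * (α - f)) / Real.sin (Real.pi * (f + α)) := by
    rw [sinRatio, ← neg_div, ← Real.sin_neg, ← mul_neg, neg_sub]
  rw [neg_eq]
  exact sin_div_sin_pos_and_abs_log_le hδ ⟨by linarith [hf.2], by linarith [hf.1]⟩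
    ⟨by linarith [hf.1], by linarith [hf.2]⟩

/-- The factor at the node `x` of the `j`-th separable term of the Dirichlet kernel multiplied by
`1 - r r'`, for the Blaschke products `r`, `r'` with parameters `p` at `x` and at the frequency. -/
noncomputable def nodeFactor (α : ℝ) (p : ℕ → ℝ) (j : ℕ) (x : ℝ) : ℂ :=
  Complex.exp (-(Real.pi * Complex.I * x)) *
    ((malmquist p j (sinRatio α x) / Real.sin (Real.pi * (x + α)) : ℝ) : ℂ)

/-- The factor at the frequency `f` that goes with `nodeFactor`. -/
noncomputable def freqFactor (N : ℕ) (α : ℝ) (p : ℕ → ℝ) (j : ℕ) (f : ℝ) : ℂ :=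
  dirichletFactor N f * ((Real.sin (2 * (Real.pi * α)) * (2 * p j) *
    malmquist p j (-sinRatio α f) / Real.sin (Real.pi * (f + α)) : ℝ) : ℂ)

-- By the addition theorem for `sinRatio` the factor `a + b` of the Christoffel-Darboux type
-- formula `one_sub_blaschkeProd_mul` cancels the only non-separable factor of the kernel.
lemma dtftVec_expVec_mul_one_sub_eq_sum {α x f : ℝ} {n : ℤ} {p : ℕ → ℝ} (hp : ∀ j, 0 < p j)
    (hn : N * x = n) (ha : 0 < sinRatio α x) (hb : 0 < -sinRatio α f) (k : ℕ) :
    dtftVec (expVec N x) f * ((1 - blaschkeProd p k (sinRatio α x) *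
      blaschkeProd p k (-sinRatio α f) : ℝ) : ℂ) =
      ∑ j ∈ Finset.range k, nodeFactor α p j x * freqFactor N α p j f := by
  have hx : Real.sin (Real.pi * (x + α)) ≠ 0 := (div_ne_zero_iff.1 ha.ne').2
  have hf : Real.sin (Real.pi * (f + α)) ≠ 0 := (div_ne_zero_iff.1 (neg_pos.1 hb).ne).2
  rw [one_sub_blaschkeProd_mul (fun j => (add_pos ha (hp j)).ne')
    (fun j => (add_pos hb (hp j)).ne'), ← sub_eq_add_neg, sinRatio_sub_sinRatio hx hf,
    Complex.ofReal_mul, Complex.ofReal_sum, ← mul_assoc, Finset.mul_sum]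
  refine Finset.sum_congr rfl fun j _ => ?_
  have kernel_eq := dtftVec_expVec_mul_sin hn f
  rw [nodeFactor, freqFactor]
  simp only [Complex.ofReal_mul, Complex.ofReal_div, Complex.ofReal_ofNat] at kernel_eq ⊢
  linear_combination (Real.sin (2 * (Real.pi * α)) / (Real.sin (Real.pi * (x + α)) *
    Real.sin (Real.pi * (f + α))) * (2 * p j * malmquist p j (sinRatio α x) *
    malmquist p j (-sinRatio α f)) : ℂ) * kernel_eq

lemma dtftVec_dftMatrix_mulVec {ι : Type*} [Fintype ι] (q : ι → ℤ) (y : ι → ℂ) (f : ℝ) :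
    dtftVec (dftMatrix N q *ᵥ y) f =
      ((1 / √(N : ℝ) : ℝ) : ℂ) * ∑ i, dtftVec (expVec N (q i / N)) f * y i := by
  rw [dtftVec, Matrix.dotProduct_mulVec, dotProduct, Finset.mul_sum]
  refine Finset.sum_congr rfl fun i _ => ?_
  rw [dtftVec, ← mul_assoc, ← smul_eq_mul _ (star _ ⬝ᵥ _), ← dotProduct_smul]
  rfl

lemma dtftVec_dftMatrix_mulVec_eq_of_orthogonal {ι : Type*} [Fintype ι] (hN : 0 < N) {q : ι → ℤ}
    {y : ι → ℂ} {α f : ℝ} {p : ℕ → ℝ} {k : ℕ} (hp : ∀ j, 0 < p j) (hf : 0 < -sinRatio α f)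
    (hy : ∀ i, y i ≠ 0 → 0 < sinRatio α (q i / N))
    (orthogonal : ∀ j < k, ∑ i, nodeFactor α p j (q i / N) * y i = 0) :
    dtftVec (dftMatrix N q *ᵥ y) f = (blaschkeProd p k (-sinRatio α f) : ℂ) *
      dtftVec (dftMatrix N q *ᵥ fun i =>
        (blaschkeProd p k (sinRatio α (q i / N)) : ℂ) * y i) f := by
  have hN' : (N : ℝ) ≠ 0 := by positivity
  have kernel_eq (i : ι) : dtftVec (expVec N (q i / N)) f * y i =
      (blaschkeProd p k (-sinRatio α f) : ℂ) * (dtftVec (expVec N (q i / N)) f *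
        ((blaschkeProd p k (sinRatio α (q i / N)) : ℂ) * y i)) +
      ∑ j ∈ Finset.range k, freqFactor N α p j f * (nodeFactor α p j (q i / N) * y i) := by
    rcases eq_or_ne (y i) 0 with hyi | hyi
    · simp [hyi]
    have separated := dtftVec_expVec_mul_one_sub_eq_sum hp
      (mul_div_cancel₀ (q i : ℝ) hN') (hy i hyi) hf k
    have sum_eq : ∑ j ∈ Finset.range k, freqFactor N α p j f * (nodeFactor α p j (q i / N) * y i) =
        (∑ j ∈ Finset.range k, nodeFactor α p j (q i / N) * freqFactor N α p j f) * y i := by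
      rw [Finset.sum_mul]
      exact Finset.sum_congr rfl fun j _ => by ring
    rw [sum_eq, ← separated]
    push_cast
    ring
  have sum_eq_zero : ∑ i, ∑ j ∈ Finset.range k,
      freqFactor N α p j f * (nodeFactor α p j (q i / N) * y i) = 0 := by
    rw [Finset.sum_comm]
    refine Finset.sum_eq_zero fun j hj => ?_
    rw [← Finset.mul_sum, orthogonal j (Finset.mem_range.1 hj), mul_zero]
  rw [dtftVec_dftMatrix_mulVec, dtftVec_dftMatrix_mulVec,
    Finset.sum_congr rfl fun i _ => kernel_eq i, Finset.sum_add_distrib, sum_eq_zero,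
    add_zero, ← Finset.mul_sum]
  ring

lemma norm_toLp_mul_le {ι : Type*} [Fintype ι] {δ : ℝ} (hδ : 0 ≤ δ) {c y : ι → ℂ}
    (hc : ∀ i, y i ≠ 0 → ‖c i‖ ≤ δ) :
    ‖WithLp.toLp 2 fun i => c i * y i‖ ≤ δ * ‖WithLp.toLp 2 y‖ := by
  refine (abs_le_of_sq_le_sq' ?_ (by positivity)).2
  rw [mul_pow, EuclideanSpace.norm_sq_eq, EuclideanSpace.norm_sq_eq, Finset.mul_sum]
  refine Finset.sum_le_sum fun i _ => ?_
  rcases eq_or_ne (y i) 0 with hyi | hyi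
  · simp [hyi]
  · rw [norm_mul, mul_pow]
    gcongr
    exact hc i hyi

lemma norm_prolate_mul_dftMatrix_mulVec_le {ι : Type*} [Fintype ι] [DecidableEq ι] (hN : 0 < N)
    (hW0 : 0 ≤ W) (hW : W ≤ 1 / 2) {q : ι → ℤ} (hq : (dftMatrix N q)ᴴ * dftMatrix N q = 1)
    {y : ι → ℂ} {α δ : ℝ} {p : ℕ → ℝ} {k : ℕ} (hp : ∀ j, 0 < p j) (hδ : 0 ≤ δ)
    (hf : ∀ f ∈ Set.Icc (-W) W,
      0 < -sinRatio α f ∧ |blaschkeProd p k (-sinRatio α f)| ≤ δ)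
    (hy : ∀ i, y i ≠ 0 → 0 < sinRatio α (q i / N) ∧ |blaschkeProd p k (sinRatio α (q i / N))| ≤ δ)
    (orthogonal : ∀ j < k, ∑ i, nodeFactor α p j (q i / N) * y i = 0) :
    ‖WithLp.toLp 2 (prolate N W *ᵥ dftMatrix N q *ᵥ y)‖ ≤ δ ^ 2 * ‖WithLp.toLp 2 y‖ := by
  set y' : ι → ℂ := fun i => (blaschkeProd p k (sinRatio α (q i / N)) : ℂ) * y i
  calc ‖WithLp.toLp 2 (prolate N W *ᵥ dftMatrix N q *ᵥ y)‖
      ≤ δ * ‖WithLp.toLp 2 (dftMatrix N q *ᵥ y')‖ := by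
        refine norm_prolate_mulVec_le_of_norm_dtftVec_le hW0 hW hδ fun f hfW => ?_
        rw [dtftVec_dftMatrix_mulVec_eq_of_orthogonal hN hp (hf f hfW).1 (fun i hi => (hy i hi).1)
          orthogonal, norm_mul, Complex.norm_real, Real.norm_eq_abs]
        gcongr
        exact (hf f hfW).2
    _ = δ * ‖WithLp.toLp 2 y'‖ := by rw [norm_toLp_mulVec_of_conjTranspose_mul_self hq]
    _ ≤ δ * (δ * ‖WithLp.toLp 2 y‖) := by
        gcongr
        refine norm_toLp_mul_le hδ fun i hi => ?_
        rw [Complex.norm_real, Real.norm_eq_abs]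
        exact (hy i hi).2
    _ = δ ^ 2 * ‖WithLp.toLp 2 y‖ := by ring

lemma card_le_finrank_ker_mulVecLin_add_card {κ ι : Type*} [Fintype κ] [Fintype ι]
    (U : Matrix κ ι ℂ) :
    Fintype.card ι ≤ Module.finrank ℂ (LinearMap.ker U.mulVecLin) + Fintype.card κ := by
  have rank_nullity := U.mulVecLin.finrank_range_add_finrank_ker
  have range_le := U.rank_le_card_height
  rw [Module.finrank_fintype_fun_eq_card] at rank_nullity
  rw [Matrix.rank] at range_le
  lia

lemma two_fifths_mul_log_add_six_le_constC (hN : 0 < N) :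
    2 / 5 * Real.log N + 6 ≤ constC N := by
  have hN' : (1 : ℝ) ≤ N := by exact_mod_cast hN
  have : 0 ≤ Real.log N := Real.log_nonneg hN'
  have coeff_le : 2 / 5 ≤ 4 / Real.pi ^ 2 := by
    rw [div_le_div_iff₀ (by norm_num) (by positivity)]
    nlinarith [Real.pi_lt_d2, Real.pi_pos]
  have log_le : Real.log N ≤ Real.log (8 * N) := Real.log_le_log (by linarith) (by linarith)
  unfold constC
  gcongr

lemma exists_blaschkeProd_le_of_constC_mul_log_le (hN : 0 < N) {ε : ℝ} (hε : ε ∈ Set.Ioo 0 1)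
    {k : ℕ} (hk : constC N * Real.log (15 / ε) ≤ (k + 2 : ℕ)) :
    ∃ p : ℕ → ℝ, (∀ j, 0 < p j) ∧
      ∀ y, 0 < y → |Real.log y| ≤ Real.log N → |blaschkeProd p k y| ≤ ε ^ (3 / 4 : ℝ) := by
  have log_gt := five_halves_lt_log_fifteen_div hε
  refine exists_abs_blaschkeProd_le hε ?_
  push_cast at hk
  nlinarith [mul_le_mul_of_nonneg_right (two_fifths_mul_log_add_six_le_constC hN)
    (show 0 ≤ Real.log (15 / ε) by linarith)]

lemma highFreq_div_mem_Icc (hN : 0 < N) {i : Fin (numHigh N W)} (hi : (i : ℕ) ≠ 0)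
    (hi' : (i : ℕ) + 1 ≠ numHigh N W) :
    (highFreq N W i / N : ℝ) ∈ Set.Icc (W + 1 / N) (1 - W - 1 / N) := by
  have hN' : (0 : ℝ) < N := by exact_mod_cast hN
  have lt_floor := Nat.lt_floor_add_one ((N : ℝ) * W)
  have le_val : (1 : ℝ) ≤ (i : ℕ) := by exact_mod_cast Nat.one_le_iff_ne_zero.2 hi
  have val_le : ((i : ℕ) : ℝ) + 2 * ⌊(N : ℝ) * W⌋₊ + 3 ≤ N := by
    have hlt := i.2
    unfold numHigh at hi' hlt
    have : (i : ℕ) + 2 * ⌊(N : ℝ) * W⌋₊ + 3 ≤ N := by lia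
    exact_mod_cast this
  have freq_eq : (highFreq N W i : ℝ) = ⌊(N : ℝ) * W⌋₊ + 1 + (i : ℕ) := by simp [highFreq]
  rw [freq_eq, Set.mem_Icc, le_div_iff₀ hN', div_le_iff₀ hN', add_mul, sub_mul, sub_mul,
    one_div_mul_cancel hN'.ne']
  constructor <;> linarith

lemma highDFT_eq_dftMatrix : highDFT N W = dftMatrix N (highFreq N W) := by
  ext
  simp [highDFT, dftMatrix, highFreq]

-- The half-cell margin `1 / (2 N)` around `W` keeps the coordinates `sinRatio` of all nodes and
-- frequencies within `[1 / N, N]` in absolute value; the two outermost nodes are sacrificed for it.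
lemma norm_prolate_mul_highDFT_mulVec_le (hN : 0 < N) (hW0 : 0 ≤ W) (hW : W < 1 / 2)
    {p : ℕ → ℝ} {k : ℕ} {δ : ℝ} (hp : ∀ j, 0 < p j) (hδ : 0 ≤ δ)
    (hr : ∀ t, 0 < t → |Real.log t| ≤ Real.log N → |blaschkeProd p k t| ≤ δ)
    {y : Fin (numHigh N W) → ℂ}
    (inner : ∀ i, y i ≠ 0 → (i : ℕ) ≠ 0 ∧ (i : ℕ) + 1 ≠ numHigh N W)
    (orthogonal : ∀ j < k, ∑ i, nodeFactor (W + 1 / (2 * N)) p j (highFreq N W i / N) * y i = 0) :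
    ‖WithLp.toLp 2 (prolate N W *ᵥ highDFT N W *ᵥ y)‖ ≤ δ ^ 2 * ‖WithLp.toLp 2 y‖ := by
  have : (0 : ℝ) < N := by exact_mod_cast hN
  rcases eq_or_ne y 0 with rfl | hy
  · simp
  obtain ⟨i₀, hi₀⟩ := Function.ne_iff.1 hy
  have node_mem (i) (hi : y i ≠ 0) := highFreq_div_mem_Icc hN (inner i hi).1 (inner i hi).2
  set η : ℝ := 1 / (2 * N) with hη
  have hη0 : 0 < η := by positivity
  have two_eta : 1 / (N : ℝ) = η + η := by rw [hη]; ring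
  have log_eq : -Real.log (2 * η) = Real.log N := by
    rw [two_mul, ← two_eta, one_div, Real.log_inv, neg_neg]
  rw [two_eta] at node_mem
  have gap := (node_mem i₀ hi₀).1.trans (node_mem i₀ hi₀).2
  rw [highDFT_eq_dftMatrix]
  refine norm_prolate_mul_dftMatrix_mulVec_le hN hW0 hW.le
    (highDFT_eq_dftMatrix (N := N) (W := W) ▸ highDFT_conjTranspose_mul_self hN hW0 hW)
    hp hδ (fun f hf => ?_) (fun i hi => ?_) orthogonal
  · obtain ⟨pos, log_le⟩ := neg_sinRatio_pos_and_abs_log_le (α := W + η) hη0 (by linarith)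
      (show f ∈ Set.Icc _ _ by rwa [add_sub_cancel_right])
    exact ⟨pos, hr _ pos (log_eq ▸ log_le)⟩
  · obtain ⟨pos, log_le⟩ := sinRatio_pos_and_abs_log_le (α := W + η) hη0 (by positivity)
      (show (highFreq N W i / N : ℝ) ∈ Set.Icc _ _ from
        ⟨by linarith [(node_mem i hi).1], by linarith [(node_mem i hi).2]⟩)
    exact ⟨pos, hr _ pos (log_eq ▸ log_le)⟩

lemma exists_submodule_norm_prolate_mul_highDFT_mulVec_le (hN : 0 < N) (hW0 : 0 ≤ W)
    (hW : W < 1 / 2) {ε : ℝ} (hε : ε ∈ Set.Ioo 0 1) {R : ℕ}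
    (hR : constC N * Real.log (15 / ε) ≤ R) :
    ∃ Y : Submodule ℂ (Fin (numHigh N W) → ℂ),
      numHigh N W ≤ Module.finrank ℂ Y + min R (numHigh N W) ∧
      ∀ y ∈ Y, ‖WithLp.toLp 2 (prolate N W *ᵥ highDFT N W *ᵥ y)‖ ≤
        ε ^ (3 / 2 : ℝ) * ‖WithLp.toLp 2 y‖ := by
  rcases le_or_gt (numHigh N W) R with hRM | hRM
  · refine ⟨⊥, by simp [hRM], fun y hy => ?_⟩
    rw [(Submodule.mem_bot ℂ).1 hy]
    simp
  have two_le_R : 2 ≤ R := by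
    have : (2 : ℝ) ≤ R := by
      nlinarith [two_fifths_mul_log_add_six_le_constC hN, five_halves_lt_log_fifteen_div hε,
        Real.log_natCast_nonneg N]
    exact_mod_cast this
  obtain ⟨k, rfl⟩ := Nat.exists_eq_add_of_le' two_le_R
  obtain ⟨p, hp, hr⟩ := exists_blaschkeProd_le_of_constC_mul_log_le hN hε hR
  let first : Fin (numHigh N W) := ⟨0, by lia⟩
  let last : Fin (numHigh N W) := ⟨numHigh N W - 1, by lia⟩
  let U : Matrix (Fin 2 ⊕ Fin k) (Fin (numHigh N W)) ℂ := Matrix.of <| Sum.elim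
    ![Pi.single first 1, Pi.single last 1]
    fun j i => nodeFactor (W + 1 / (2 * N)) p j (highFreq N W i / N)
  refine ⟨LinearMap.ker U.mulVecLin, ?_, fun y hy => ?_⟩
  · have := card_le_finrank_ker_mulVecLin_add_card U
    simp only [Fintype.card_fin, Fintype.card_sum] at this
    lia
  have row_eq_zero (κ) : U κ ⬝ᵥ y = 0 := congrFun (LinearMap.mem_ker.1 hy) κ
  have first_eq_zero : y first = 0 :=
    (single_one_dotProduct first y).symm.trans (row_eq_zero (Sum.inl 0))
  have last_eq_zero : y last = 0 :=
    (single_one_dotProduct last y).symm.trans (row_eq_zero (Sum.inl 1))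
  have pow_eq : ε ^ (3 / 2 : ℝ) = (ε ^ (3 / 4 : ℝ)) ^ 2 := by
    rw [← Real.rpow_natCast, ← Real.rpow_mul hε.1.le]
    norm_num
  rw [pow_eq]
  refine norm_prolate_mul_highDFT_mulVec_le hN hW0 hW hp (Real.rpow_nonneg hε.1.le _) hr
    (fun i hi => ⟨fun h => hi ?_, fun h => hi ?_⟩) fun j hj => row_eq_zero (Sum.inr ⟨j, hj⟩)
  · rwa [show i = first from Fin.ext h]
  · rwa [show i = last from Fin.ext (by simp only [last]; lia)]

lemma norm_one_sub_mul_highDFT_conjTranspose_mul_prolate_le (hN : 0 < N) (hW0 : 0 ≤ W)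
    (hW : W < 1 / 2) {ε : ℝ} (hε : ε ∈ Set.Ioo 0 1) {R : ℕ}
    (hR : constC N * Real.log (15 / ε) ≤ R)
    {V : Matrix (Fin (numHigh N W)) (Fin (min R (numHigh N W))) ℂ}
    (hV : IsDominantLeftSingularVectors ((highDFT N W)ᴴ * prolate N W) V) :
    ‖(1 - V * Vᴴ) * ((highDFT N W)ᴴ * prolate N W)‖ ≤ ε ^ (3 / 2 : ℝ) := by
  obtain ⟨Y, hY, hYle⟩ := exists_submodule_norm_prolate_mul_highDFT_mulVec_le hN hW0 hW hε hR
  refine hV.norm_one_sub_mul_le hY (Real.rpow_nonneg hε.1.le _) fun y hy => ?_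
  rw [Matrix.conjTranspose_mul, Matrix.conjTranspose_conjTranspose, (isHermitian_prolate N W).eq,
    ← Matrix.mulVec_mulVec]
  exact hYle y hy

end KeyEstimate

/-! ### Slepian vectors -/

section DPSS

variable {N K : ℕ} {W ε : ℝ} {s : Fin N → ℤ → ℝ} {lam : Fin N → ℝ}

lemma dtft_timeLimit (x : ℤ → ℂ) (f : ℝ) :
    dtft (timeLimit N x) f = dtftVec (fun n : Fin N => x (n : ℕ)) f := by
  have cast_injective : Function.Injective fun n : Fin N => ((n : ℕ) : ℤ) := fun a b h =>
    Fin.ext (by simpa using h)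
  rw [dtft, ← cast_injective.tsum_eq, tsum_fintype]
  · refine Finset.sum_congr rfl fun n _ => ?_
    rw [timeLimit, if_pos (by have := n.2; omega), mul_comm, Pi.star_apply, expVec,
      RCLike.star_def, ← Complex.exp_conj]
    congr 2
    simp [Complex.conj_ofNat]
  · intro n hn
    by_contra hrange
    refine hn ?_
    have timeLimit_eq_zero : timeLimit N x n = 0 :=
      if_neg fun hn' => hrange ⟨⟨n.toNat, by omega⟩, by simp [hn'.1]⟩
    simp only [timeLimit_eq_zero, zero_mul]

lemma bandLimit_timeLimit (x : ℤ → ℂ) (m : Fin N) :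
    bandLimit W (timeLimit N x) (m : ℕ) = (prolate N W *ᵥ fun n => x (n : ℕ)) m := by
  simp only [bandLimit, prolate_mulVec_apply, dtft_timeLimit, expVec, Int.cast_natCast, mul_comm]

namespace IsDPSS

lemma prolate_mul_dpssMatrix (hs : IsDPSS N W s lam) (hK : K ≤ N) :
    prolate N W * dpssMatrix s hK =
      dpssMatrix s hK * Matrix.diagonal fun ℓ => (lam (Fin.castLE hK ℓ) : ℂ) := by
  ext m ℓ
  rw [Matrix.mul_diagonal, mul_comm]
  exact (bandLimit_timeLimit _ m).symm.trans (hs.eigen (Fin.castLE hK ℓ) m)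

lemma dpssMatrix_conjTranspose_mul_self (hs : IsDPSS N W s lam) (hK : K ≤ N) :
    (dpssMatrix s hK)ᴴ * dpssMatrix s hK = 1 := by
  ext i j
  have orthonormal := hs.orthonormal (Fin.castLE hK i) (Fin.castLE hK j)
  simp only [(Fin.castLE_injective hK).eq_iff] at orthonormal
  simp only [Matrix.mul_apply, Matrix.conjTranspose_apply, dpssMatrix, Matrix.of_apply, dpssVec,
    RCLike.star_def, Complex.conj_ofReal, Matrix.one_apply, ← Complex.ofReal_mul,
    ← Complex.ofReal_sum, orthonormal]
  split_ifs <;> simp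

lemma norm_mul_dpssMatrix_le (hs : IsDPSS N W s lam) (hK : K ≤ N) (hε : 0 < ε)
    (hlam : ∀ ℓ : Fin K, ε ≤ lam (Fin.castLE hK ℓ)) {ι : Type*} [Fintype ι]
    (A : Matrix ι (Fin N) ℂ) : ‖A * dpssMatrix s hK‖ ≤ ‖A * prolate N W‖ * ε⁻¹ := by
  have hpos (ℓ : Fin K) : 0 < lam (Fin.castLE hK ℓ) := hε.trans_le (hlam ℓ)
  set S := dpssMatrix s hK
  set invLam : Fin K → ℂ := fun ℓ => (lam (Fin.castLE hK ℓ) : ℂ)⁻¹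
  have eq_prolate_mul : S = prolate N W * (S * Matrix.diagonal invLam) := by
    rw [← Matrix.mul_assoc, hs.prolate_mul_dpssMatrix hK, Matrix.mul_assoc,
      Matrix.diagonal_mul_diagonal]
    simp only [invLam, mul_inv_cancel₀ (Complex.ofReal_ne_zero.2 (hpos _).ne'),
      Matrix.diagonal_one, Matrix.mul_one, S]
  have norm_S : ‖S‖ ≤ 1 :=
    norm_le_one_of_conjTranspose_mul_self (hs.dpssMatrix_conjTranspose_mul_self hK)
  have norm_invLam : ‖Matrix.diagonal invLam‖ ≤ ε⁻¹ := by
    rw [Matrix.l2_opNorm_diagonal]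
    refine (pi_norm_le_iff_of_nonneg (inv_nonneg.2 hε.le)).2 fun ℓ => ?_
    rw [norm_inv, Complex.norm_of_nonneg (hpos ℓ).le]
    exact inv_anti₀ hε (hlam ℓ)
  calc ‖A * S‖ = ‖A * prolate N W * (S * Matrix.diagonal invLam)‖ := by
        rw [Matrix.mul_assoc, ← eq_prolate_mul]
    _ ≤ ‖A * prolate N W‖ * (‖S‖ * ‖Matrix.diagonal invLam‖) :=
        (Matrix.l2_opNorm_mul _ _).trans <| by gcongr; exact Matrix.l2_opNorm_mul _ _
    _ ≤ ‖A * prolate N W‖ * (1 * ε⁻¹) := by gcongr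
    _ = ‖A * prolate N W‖ * ε⁻¹ := by rw [one_mul]

lemma norm_one_sub_roast_mul_dpssMatrix_sq_le (hs : IsDPSS N W s lam)
    (hW : W ∈ Set.Ioo (0 : ℝ) (1 / 2)) (hε : ε ∈ Set.Ioo (0 : ℝ) 1) (hN : 0 < N) (hK : K ≤ N)
    (hlam : ∀ ℓ : Fin K, ε ≤ lam (Fin.castLE hK ℓ)) {R : ℕ}
    (hR : constC N * Real.log (15 / ε) ≤ R)
    {V : Matrix (Fin (numHigh N W)) (Fin (min R (numHigh N W))) ℂ}
    (hV : IsDominantLeftSingularVectors ((highDFT N W)ᴴ * prolate N W) V) :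
    ‖(1 - roast N W V * (roast N W V)ᴴ) * dpssMatrix s hK‖ ^ 2 ≤ ε := by
  rw [← Real.le_sqrt (norm_nonneg _) hε.1.le]
  have norm_highDFT : ‖highDFT N W‖ ≤ 1 :=
    norm_le_one_of_conjTranspose_mul_self (highDFT_conjTranspose_mul_self hN hW.1.le hW.2)
  calc ‖(1 - roast N W V * (roast N W V)ᴴ) * dpssMatrix s hK‖
      ≤ ‖(1 - roast N W V * (roast N W V)ᴴ) * prolate N W‖ * ε⁻¹ :=
        hs.norm_mul_dpssMatrix_le hK hε.1 hlam _
    _ = ‖highDFT N W * ((1 - V * Vᴴ) * ((highDFT N W)ᴴ * prolate N W))‖ * ε⁻¹ := by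
        rw [one_sub_roast_mul_conjTranspose hN hW.1.le hW.2, Matrix.mul_assoc, Matrix.mul_assoc]
    _ ≤ 1 * ε ^ (3 / 2 : ℝ) * ε⁻¹ := by
        have := inv_nonneg.2 hε.1.le
        refine mul_le_mul_of_nonneg_right ((Matrix.l2_opNorm_mul _ _).trans ?_) this
        gcongr
        exact norm_one_sub_mul_highDFT_conjTranspose_mul_prolate_le hN hW.1.le hW.2 hε hR hV
    _ = √ε := by
        rw [one_mul, ← Real.rpow_neg_one, ← Real.rpow_add hε.1, Real.sqrt_eq_rpow]
        norm_num

end IsDPSS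

end DPSS

/-! ### Column spaces and the subspace angle -/

section Projection

variable {𝕜 E : Type*} [RCLike 𝕜] [NormedAddCommGroup E] [InnerProductSpace 𝕜 E]
  {S T : Submodule 𝕜 E}

lemma norm_sq_sub_norm_sub_sq_le_norm_starProjection_sq [T.HasOrthogonalProjection] (a : E)
    {q : E} (hq : q ∈ T) :
    ‖a‖ ^ 2 - ‖a - q‖ ^ 2 ≤ ‖T.starProjection a‖ ^ 2 := by
  have projection_minimal : ‖a - T.starProjection a‖ ≤ ‖a - q‖ := by
    rw [Submodule.starProjection_minimal]
    exact ciInf_le ⟨0, by rintro _ ⟨x, rfl⟩; positivity⟩ (⟨q, hq⟩ : T)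
  have pythagoras := T.norm_sq_eq_add_norm_sq_starProjection a
  rw [Submodule.starProjection_orthogonal_val] at pythagoras
  have := pow_le_pow_left₀ (norm_nonneg _) projection_minimal 2
  linarith

lemma finrank_le_finrank_of_starProjection_ne_zero [FiniteDimensional 𝕜 T]
    (h : ∀ a ∈ S, a ≠ 0 → T.starProjection a ≠ 0) :
    Module.finrank 𝕜 S ≤ Module.finrank 𝕜 T := by
  let projection : S →ₗ[𝕜] T := (T.orthogonalProjectionOnto : _ →ₗ[𝕜] T).comp S.subtype
  refine LinearMap.finrank_le_finrank_of_injective (f := projection) ?_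
  rw [← LinearMap.ker_eq_bot, LinearMap.ker_eq_bot']
  intro a ha
  by_contra ha0
  refine h a a.2 (Subtype.coe_injective.ne ha0) ?_
  rw [Submodule.starProjection_apply]
  exact congrArg Subtype.val ha

lemma exists_mem_norm_eq_one (hS : S ≠ ⊥) : ∃ a ∈ S, ‖a‖ = 1 := by
  obtain ⟨a, ha, ha0⟩ := (Submodule.ne_bot_iff _).1 hS
  exact ⟨_, S.smul_mem (‖a‖⁻¹ : 𝕜) ha, norm_smul_inv_norm ha0⟩

end Projection

section SubspaceAngle

variable {N : ℕ} {ε : ℝ} {S T : Submodule ℂ (EuclideanSpace ℂ (Fin N))}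

lemma le_infProj (hS : S ≠ ⊥) {c : ℝ} (h : ∀ a ∈ S, ‖a‖ = 1 → c ≤ ‖T.starProjection a‖) :
    c ≤ infProj S T := by
  obtain ⟨a, ha, ha1⟩ := exists_mem_norm_eq_one hS
  refine le_csInf ⟨_, a, ha, ha1, rfl⟩ ?_
  rintro _ ⟨b, hb, hb1, rfl⟩
  exact h b hb hb1

lemma infProj_le_one (hS : S ≠ ⊥) : infProj S T ≤ 1 := by
  obtain ⟨a, ha, ha1⟩ := exists_mem_norm_eq_one hS
  have bddBelow : BddBelow {x : ℝ | ∃ b ∈ S, ‖b‖ = 1 ∧ x = ‖T.starProjection b‖} :=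
    ⟨0, by rintro _ ⟨b, -, -, rfl⟩; exact norm_nonneg _⟩
  calc infProj S T ≤ ‖T.starProjection a‖ := csInf_le bddBelow ⟨a, ha, ha1, rfl⟩
    _ ≤ ‖a‖ := T.norm_starProjection_apply_le a
    _ = 1 := ha1

lemma sqrt_one_sub_le_cos_subspaceAngle (hε : ε < 1) (hS : S ≠ ⊥)
    (h : ∀ a ∈ S, ∃ q ∈ T, ‖a - q‖ ^ 2 ≤ ε * ‖a‖ ^ 2) :
    √(1 - ε) ≤ Real.cos (subspaceAngle S T) := by
  have norm_projection (a) (ha : a ∈ S) : (1 - ε) * ‖a‖ ^ 2 ≤ ‖T.starProjection a‖ ^ 2 := by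
    obtain ⟨q, hq, hle⟩ := h a ha
    linarith [norm_sq_sub_norm_sub_sq_le_norm_starProjection_sq a hq]
  have finrank_le : Module.finrank ℂ S ≤ Module.finrank ℂ T := by
    refine finrank_le_finrank_of_starProjection_ne_zero fun a ha ha0 => ?_
    have : 0 < (1 - ε) * ‖a‖ ^ 2 := mul_pos (sub_pos.2 hε) (by positivity)
    exact norm_ne_zero_iff.1 (pow_ne_zero_iff two_ne_zero |>.1
      (this.trans_le (norm_projection a ha)).ne')
  have sqrt_le : √(1 - ε) ≤ infProj S T := le_infProj hS fun a ha ha1 => by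
    refine (Real.sqrt_le_left (norm_nonneg _)).2 ?_
    simpa only [ha1, one_pow, mul_one] using norm_projection a ha
  rwa [subspaceAngle, if_pos finrank_le,
    Real.cos_arccos (by linarith [Real.sqrt_nonneg (1 - ε)]) (infProj_le_one hS)]

end SubspaceAngle

section ColumnSpace

variable {N : ℕ} {ε : ℝ} {ι κ : Type*} [Fintype ι] [Fintype κ]

lemma mem_colSpace_iff {A : Matrix (Fin N) ι ℂ} {a : EuclideanSpace ℂ (Fin N)} :
    a ∈ colSpace A ↔ ∃ c : ι → ℂ, WithLp.toLp 2 (A *ᵥ c) = a := by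
  rw [colSpace, Submodule.mem_span_range_iff_exists_fun]
  refine exists_congr fun c => Eq.congr_left ?_
  ext j
  simp [Matrix.mulVec, dotProduct, mul_comm]

variable [DecidableEq ι] {A : Matrix (Fin N) ι ℂ} {Q : Matrix (Fin N) κ ℂ}

lemma opNorm_sub_mul_conjTranspose_sq_le (hA : Aᴴ * A = 1) (h : ‖(1 - Q * Qᴴ) * A‖ ^ 2 ≤ ε) :
    opNorm (A * Aᴴ - Q * Qᴴ * (A * Aᴴ)) ^ 2 ≤ ε := by
  have factor : A * Aᴴ - Q * Qᴴ * (A * Aᴴ) = (1 - Q * Qᴴ) * A * Aᴴ := by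
    simp only [Matrix.sub_mul, Matrix.one_mul, Matrix.mul_assoc]
  have norm_conjTranspose : ‖Aᴴ‖ ≤ 1 :=
    (Matrix.l2_opNorm_conjTranspose A).trans_le (norm_le_one_of_conjTranspose_mul_self hA)
  calc opNorm (A * Aᴴ - Q * Qᴴ * (A * Aᴴ)) ^ 2 = ‖(1 - Q * Qᴴ) * A * Aᴴ‖ ^ 2 := by
        rw [factor]; rfl
    _ ≤ (‖(1 - Q * Qᴴ) * A‖ * 1) ^ 2 := by
        gcongr
        exact (Matrix.l2_opNorm_mul _ _).trans (by gcongr)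
    _ ≤ ε := by rwa [mul_one]

lemma norm_toLp_mulVec_sub_sq_le (h : ‖(1 - Q * Qᴴ) * A‖ ^ 2 ≤ ε) (c : ι → ℂ) :
    ‖WithLp.toLp 2 (A *ᵥ c - (Q * Qᴴ) *ᵥ (A *ᵥ c))‖ ^ 2 ≤ ε * ‖WithLp.toLp 2 c‖ ^ 2 := by
  have factor : A *ᵥ c - (Q * Qᴴ) *ᵥ (A *ᵥ c) = ((1 - Q * Qᴴ) * A) *ᵥ c := by
    rw [← Matrix.mulVec_mulVec c, Matrix.sub_mulVec, Matrix.one_mulVec]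
  calc ‖WithLp.toLp 2 (A *ᵥ c - (Q * Qᴴ) *ᵥ (A *ᵥ c))‖ ^ 2
      ≤ (‖(1 - Q * Qᴴ) * A‖ * ‖WithLp.toLp 2 c‖) ^ 2 := by
        rw [factor]
        gcongr
        exact Matrix.l2_opNorm_mulVec _ _
    _ ≤ ε * ‖WithLp.toLp 2 c‖ ^ 2 := by rw [mul_pow]; gcongr

omit [Fintype ι] in
lemma colSpace_ne_bot [Nonempty ι] (hA : Aᴴ * A = 1) : colSpace A ≠ ⊥ := by
  obtain ⟨j⟩ := ‹Nonempty ι›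
  refine (Submodule.ne_bot_iff _).2 ⟨_, Submodule.subset_span ⟨j, rfl⟩, fun h => ?_⟩
  have column_eq_zero (i) : A i j = 0 := congrArg (fun v => v i) h
  simpa [Matrix.mul_apply, column_eq_zero] using congrFun₂ hA j j

lemma sqrt_one_sub_le_cos_subspaceAngle_colSpace [Nonempty ι] (hε : ε < 1) (hA : Aᴴ * A = 1)
    (h : ‖(1 - Q * Qᴴ) * A‖ ^ 2 ≤ ε) :
    √(1 - ε) ≤ Real.cos (subspaceAngle (colSpace A) (colSpace Q)) := by
  refine sqrt_one_sub_le_cos_subspaceAngle hε (colSpace_ne_bot hA) fun a ha => ?_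
  obtain ⟨c, rfl⟩ := mem_colSpace_iff.1 ha
  refine ⟨_, mem_colSpace_iff.2 ⟨Qᴴ *ᵥ (A *ᵥ c), rfl⟩, ?_⟩
  rw [← WithLp.toLp_sub, Matrix.mulVec_mulVec _ Q, norm_toLp_mulVec_of_conjTranspose_mul_self hA]
  exact norm_toLp_mulVec_sub_sq_le h c

end ColumnSpace

end Slepian

open scoped Matrix in
theorem theorem3_general {N : ℕ} {W ε : ℝ} (hW : W ∈ Set.Ioo (0 : ℝ) (1 / 2))
    (hε : ε ∈ Set.Ioo (0 : ℝ) 1) {s : Fin N → ℤ → ℝ} {lam : Fin N → ℝ}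
    (hs : Slepian.IsDPSS N W s lam) {K : ℕ} (hK1 : 1 ≤ K) (hKN : K ≤ N)
    (hlam : ∀ ℓ : Fin K, ε ≤ lam (Fin.castLE hKN ℓ)) {R : ℕ}
    (hR : Slepian.constC N * Real.log (15 / ε) ≤ R)
    {V : Matrix (Fin (Slepian.numHigh N W)) (Fin (min R (Slepian.numHigh N W))) ℂ}
    (hV : Slepian.IsDominantLeftSingularVectors
      ((Slepian.highDFT N W)ᴴ * Slepian.prolate N W) V) :
    (Slepian.roast N W V)ᴴ * Slepian.roast N W V = 1 ∧
    Slepian.opNorm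
      (Slepian.dpssMatrix s hKN * (Slepian.dpssMatrix s hKN)ᴴ -
        Slepian.roast N W V * (Slepian.roast N W V)ᴴ *
          (Slepian.dpssMatrix s hKN * (Slepian.dpssMatrix s hKN)ᴴ)) ^ 2 ≤ ε ∧
    (∀ ℓ : Fin N, (ℓ : ℕ) < K →
      ‖WithLp.toLp 2 (Slepian.dpssVec s ℓ -
        (Slepian.roast N W V * (Slepian.roast N W V)ᴴ) *ᵥ Slepian.dpssVec s ℓ)‖ ^ 2 ≤ ε) ∧
    √(1 - ε) ≤
      Real.cos (Slepian.subspaceAngle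
        (Slepian.colSpace (Slepian.dpssMatrix s hKN))
        (Slepian.colSpace (Slepian.roast N W V))) := by
  have hN : 0 < N := hK1.trans hKN
  have orthonormal := hs.dpssMatrix_conjTranspose_mul_self hKN
  have residual := hs.norm_one_sub_roast_mul_dpssMatrix_sq_le hW hε hN hKN hlam hR hV
  have : Nonempty (Fin K) := ⟨⟨0, hK1⟩⟩
  refine ⟨Slepian.roast_conjTranspose_mul_self hN hW.1.le hW.2 hV.conjTranspose_mul_self,
    Slepian.opNorm_sub_mul_conjTranspose_sq_le orthonormal residual, fun ℓ hℓ => ?_,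
    Slepian.sqrt_one_sub_le_cos_subspaceAngle_colSpace hε.2 orthonormal residual⟩
  have column : Slepian.dpssMatrix s hKN *ᵥ Pi.single ⟨ℓ, hℓ⟩ 1 = Slepian.dpssVec s ℓ :=
    Matrix.mulVec_single_one _ _
  simpa only [column, PiLp.toLp_single, PiLp.norm_single, norm_one, one_pow, mul_one]
    using Slepian.norm_toLp_mulVec_sub_sq_le residual (Pi.single ⟨ℓ, hℓ⟩ 1)

open scoped Matrix in
theorem theorem3 (N : ℕ) (W ε : ℝ) (hW : W ∈ Set.Ioo (0 : ℝ) (1 / 2))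
    (hε : ε ∈ Set.Ioo (0 : ℝ) (1 / 2))
    (s : Fin N → ℤ → ℝ) (lam : Fin N → ℝ) (hs : Slepian.IsDPSS N W s lam)
    (K : ℕ) (hK1 : 1 ≤ K) (hKN : K ≤ N) (hK : ε ≤ lam ⟨K - 1, by omega⟩) :
    (∀ V : Matrix (Fin (Slepian.numHigh N W))
        (Fin (min ⌈Slepian.constC N * Real.log (15 / ε)⌉₊ (Slepian.numHigh N W))) ℂ,
      Slepian.IsDominantLeftSingularVectors
        ((Slepian.highDFT N W)ᴴ * Slepian.prolate N W) V →
      (Slepian.roast N W V)ᴴ * Slepian.roast N W V = 1 ∧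
      Slepian.opNorm
        (Slepian.dpssMatrix s hKN * (Slepian.dpssMatrix s hKN)ᴴ -
          Slepian.roast N W V * (Slepian.roast N W V)ᴴ *
            (Slepian.dpssMatrix s hKN * (Slepian.dpssMatrix s hKN)ᴴ)) ^ 2 ≤ ε ∧
      ∀ ℓ : Fin N, (ℓ : ℕ) < K →
        ‖WithLp.toLp 2 (Slepian.dpssVec s ℓ -
          (Slepian.roast N W V * (Slepian.roast N W V)ᴴ) *ᵥ Slepian.dpssVec s ℓ)‖ ^ 2 ≤ ε) ∧
    (∀ V : Matrix (Fin (Slepian.numHigh N W))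
        (Fin (min ⌈Slepian.constC N * Real.log (15 * (N : ℝ) / ε)⌉₊ (Slepian.numHigh N W))) ℂ,
      Slepian.IsDominantLeftSingularVectors
        ((Slepian.highDFT N W)ᴴ * Slepian.prolate N W) V →
      (Slepian.roast N W V)ᴴ * Slepian.roast N W V = 1 ∧
      Real.sqrt (1 - ε) ≤
        Real.cos (Slepian.subspaceAngle
          (Slepian.colSpace (Slepian.dpssMatrix s hKN))
          (Slepian.colSpace (Slepian.roast N W V)))) := by
  obtain ⟨hε0, hε1⟩ := hε
  have hε : ε ∈ Set.Ioo (0 : ℝ) 1 := ⟨hε0, by linarith⟩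
  have hlam (ℓ : Fin K) : ε ≤ lam (Fin.castLE hKN ℓ) :=
    hK.trans (hs.antitone (Fin.le_def.2 (Nat.le_sub_one_of_lt ℓ.2)))
  have ceil_le : Slepian.constC N * Real.log (15 / ε) ≤
      ⌈Slepian.constC N * Real.log (15 * (N : ℝ) / ε)⌉₊ := by
    have hN : (1 : ℝ) ≤ N := mod_cast hK1.trans hKN
    have constC_nonneg : 0 ≤ Slepian.constC N := by
      linarith [Slepian.two_fifths_mul_log_add_six_le_constC (hK1.trans hKN), Real.log_nonneg hN]
    refine le_trans ?_ (Nat.le_ceil _)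
    gcongr
    exact le_mul_of_one_le_right (by norm_num) hN
  refine ⟨fun V hV => ?_, fun V hV => ?_⟩
  · obtain ⟨isometry, opNorm_le, columns_le, -⟩ :=
      theorem3_general hW hε hs hK1 hKN hlam (Nat.le_ceil _) hV
    exact ⟨isometry, opNorm_le, columns_le⟩
  · obtain ⟨isometry, -, -, angle⟩ := theorem3_general hW hε hs hK1 hKN hlam ceil_le hV
    exact ⟨isometry, angle⟩
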